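/- For $n\ge 1$ and $|z|<1$ let $\mathrm{Li}_n(z)=\sum_{k\ge1}z^k/k^n$, and define the real numbers $$B_n+iF_n=2^{n-1}\,\mathrm{Li}_n\!\left(\tfrac{1+i}{2}\right),\qquad D_n+iG_n=\left(\tfrac23\right)^{n-1}\mathrm{Li}_n\!\left(\tfrac{1+i}{4}\right)-\mathrm{Li}_n\!\left(\tfrac{-i}{2}\right).$$ Define the meromorphic functions $$F(t)=2t\sum_{k\ge1}\frac{\left(\frac{1+i}{2}\right)^k}{k-2t},\qquad G(t)=2t\sum_{k\ge1}\left\{\frac{\left(\frac{1+i}{4}\right)^k}{k-2t/3}-\frac{\left(\frac{-i}{2}\right)^k}{k-t}\right\}.$$ Let $(a)_n=a(a+1)\cdots(a+n-1)$, ${}_2F_1(a,b;c;z)=\sum_{n\ge0}\frac{(a)_n(b)_n}{(c)_n\,n!}z^n$ and ${}_3F_2(a,b,c;d,e;z)=\sum_{n\ge0}\frac{(a)_n(b)_n(c)_n}{(d)_n(e)_n\,n!}z^n$. For a function $f$ write $(\Im f)(t)=\bigl(f(t)-\overline{f(\bar t)}\bigr)/(2i)$, which is the imaginary part of $f(t)$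 when $t$ is real. Then the following hold. 1. $F(t)=2\sum_{n\ge1}(B_n+iF_n)t^n$ for all complex $|t|<\frac12$, and $G(t)=2\sum_{n\ge1}(D_n+iG_n)t^n$ for all complex $|t|<1$. 2. (Shift recurrences.) For all complex $t$ with $2t\notin\{0,1,2,\dots\}$, $$\frac{2F(t)}{t}-\frac{iF(t-1)-i}{t-1}=\frac{2+2i}{1-2t},$$ and for all complex $t$ with $t\ne k$ and $t\ne\frac32k$ for every integer $k\ge0$, $$\frac{2^3G(t)}{t}-\frac{iG(t-3)-i}{t-3}=\frac{12+12i}{3-2t}+\frac{8i}{1-t}+\frac{4}{2-t}.$$ 3. For all complex $t$ with $\Re t<\frac12$ the following series ${}_3F_2$ converges absolutely and $$(\Im F)(t)=\frac{t}{1-t}\;{}_3F_2\!\left(\tfrac12-\tfrac12t,\ \tfrac12,\ 1;\ \tfrac32-\tfrac12t,\ 1-t;\ 1\right);$$ for $|t|<\frac12$ the right-hand side equals $2\sum_{n\ge1}F_nt^n$. 4. For all complex $t\neq1$ with $\Re t<\frac32$ the following series ${}_3F_2$ converges absolutely and $$(\Im G)(t)=\frac{t}{1-t}\;{}_3F_2\!\left(\tfrac12-\tfrac12t,\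 \tfrac12-\tfrac13t,\ 1;\ \tfrac32-\tfrac12t,\ 1-\tfrac23t;\ 1\right);$$ for $|t|<1$ the right-hand side equals $2\sum_{n\ge1}G_nt^n$. 5. $2F_1=2G_1={}_2F_1\!\left(\tfrac12,\tfrac12;\tfrac32;1\right)=\tfrac{\pi}{2}$ (here $F_1,G_1$ are the numbers $F_n,G_n$ with $n=1$). 6. Catalan's constant $\beta(2)=\sum_{k\ge0}\frac{(-1)^k}{(2k+1)^2}$ satisfies $$\beta(2)=\sum_{n=1}^{\infty}\frac{\left(\frac12\right)^{2n+1}}{2n+1}\binom{2n}{n}H_{2n},\qquad H_{2n}=\sum_{m=1}^{2n}\frac1m .$$ -/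

import Mathlib

open scoped ComplexConjugate

noncomputable section

namespace Ladder

/-- The polylogarithm `Li_n(z) = ∑_{k ≥ 1} z ^ k / k ^ n` (used for `‖z‖ < 1` only). -/
def polylog (n : ℕ) (z : ℂ) : ℂ :=
  ∑' k : ℕ, z ^ (k + 1) / ((k : ℂ) + 1) ^ n

/-- `B_n = Re (2 ^ (n - 1) Li_n((1 + i) / 2))`. -/
def B (n : ℕ) : ℝ :=
  ((2 : ℂ) ^ ((n : ℤ) - 1) * polylog n ((1 + Complex.I) / 2)).re

/-- `F_n = Im (2 ^ (n - 1) Li_n((1 + i) / 2))`. -/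
def F (n : ℕ) : ℝ :=
  ((2 : ℂ) ^ ((n : ℤ) - 1) * polylog n ((1 + Complex.I) / 2)).im

/-- `D_n = Re ((2 / 3) ^ (n - 1) Li_n((1 + i) / 4) - Li_n(-i / 2))`. -/
def D (n : ℕ) : ℝ :=
  ((2 / 3 : ℂ) ^ ((n : ℤ) - 1) * polylog n ((1 + Complex.I) / 4)
    - polylog n (-Complex.I / 2)).re

/-- `G_n = Im ((2 / 3) ^ (n - 1) Li_n((1 + i) / 4) - Li_n(-i / 2))`. -/
def G (n : ℕ) : ℝ :=
  ((2 / 3 : ℂ) ^ ((n : ℤ) - 1) * polylog n ((1 + Complex.I) / 4)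
    - polylog n (-Complex.I / 2)).im

/-- `F(t) = 2 t ∑_{k ≥ 1} ((1 + i) / 2) ^ k / (k - 2 t)`, meromorphic with poles at `2 t = 1, 2, …`. -/
def genF (t : ℂ) : ℂ :=
  2 * t * ∑' k : ℕ, ((1 + Complex.I) / 2) ^ (k + 1) / (((k : ℂ) + 1) - 2 * t)

/-- `G(t) = 2 t ∑_{k ≥ 1} (((1 + i) / 4) ^ k / (k - 2 t / 3) - (-i / 2) ^ k / (k - t))`,
meromorphic with poles among `t = k` and `t = 3 k / 2`, `k = 1, 2, …`. -/
def genG (t : ℂ) : ℂ :=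
  2 * t * ∑' k : ℕ, (((1 + Complex.I) / 4) ^ (k + 1) / (((k : ℂ) + 1) - 2 * t / 3)
    - (-Complex.I / 2) ^ (k + 1) / (((k : ℂ) + 1) - t))

/-- The imaginary part of a generating function, taken coefficientwise in the variable `t`:
`(f(t) - conj (f(conj t))) / (2 i)`. At real `t` it is the ordinary imaginary part of `f(t)`. -/
def imGen (f : ℂ → ℂ) (t : ℂ) : ℂ :=
  (f t - conj (f (conj t))) / (2 * Complex.I)

/-- The `n`-th term of the series `₃F₂(a, b, c; d, e; z)`. -/
def hyp3F2Term (a b c d e z : ℂ) (n : ℕ) : ℂ :=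
  (ascPochhammer ℂ n).eval a * (ascPochhammer ℂ n).eval b * (ascPochhammer ℂ n).eval c
    / ((ascPochhammer ℂ n).eval d * (ascPochhammer ℂ n).eval e)
    * (z ^ n / (n.factorial : ℂ))

/-- The sum of the series `₃F₂(a, b, c; d, e; z)`. -/
def hyp3F2 (a b c d e z : ℂ) : ℂ :=
  ∑' n : ℕ, hyp3F2Term a b c d e z n

/-- Catalan's constant `∑_{k ≥ 0} (-1) ^ k / (2 k + 1) ^ 2`. -/
def catalanConst : ℝ :=
  ∑' k : ℕ, (-1 : ℝ) ^ k / (2 * (k : ℝ) + 1) ^ 2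

end Ladder

end

noncomputable section

namespace Ladder

open Filter Topology Asymptotics
open scoped ComplexConjugate

/-! Write `lerchSum z s` for the sum of z^k/(k - s) over k ≥ 1. Expanding 1/(k - s) geometrically in
s/k gives the polylogarithm series. Peeling off the first term gives L(s) = z/(1 - s) + z L(s - 1).
The shift recurrences follow from ((1+i)/2)^2 = i/2 and ((1+i)/4)^2 = (-i/2)^3 = i/8: the two
ladders in `genG` acquire the same multiplier when t moves by 3.

For the hypergeometric forms, the parameters a, a + 1 and 1 collapse the 3F2 to `pochSum`, the sum
of (b)_n / ((e)_n (2n + 2a)). The imaginary parts `imF` and `imG` satisfy x(t) = rational - x(t -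
2)/4 and x(t) = rational - x(t - 6)/64, because fourth and sixth powers of the arguments are real.
`pochSum_half_step` and `pochSum_double_step` show by explicit telescoping that the matching
`pochSum` obeys the same recurrence. The difference D of two solutions satisfies D(t) = q D(t - p)
with |q| < 1 and grows at most linearly to the left, so it vanishes (`eq_zero_of_recurrence`).

For Catalan's constant, put W(x) = ∑ c_n/(2n + 1 + x) with c_n = binom(2n, n)/4^n; this is the
Wallis integral of sin^x over [0, π/2], handled here only as a series. Writing H_{2n+1} as a series
in k and exchanging sums turns ∑ c_n H_{2n+1}/(2n + 1) into ∑ W(k + 1)/(k + 1). The terms with W at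
odd arguments sum to 2β(2), those at even arguments to ∑ c_n/(2n + 1)^2. The latter is exactly the
correction between H_{2n+1} and H_{2n}. -/

/-! ### Rising factorials and their asymptotics -/

/-- The rising factorial `(a)_n`. -/
def poch (a : ℂ) (n : ℕ) : ℂ := (ascPochhammer ℂ n).eval a

lemma poch_zero (a : ℂ) : poch a 0 = 1 := by simp [poch]

lemma poch_succ (a : ℂ) (n : ℕ) : poch a (n + 1) = poch a n * (a + n) :=
  ascPochhammer_succ_eval n a

lemma poch_succ_left (a : ℂ) (n : ℕ) : poch a (n + 1) = a * poch (a + 1) n := by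
  induction n with
  | zero => simp [poch_succ, poch_zero]
  | succ n ih => rw [poch_succ, ih, poch_succ]; push_cast; ring

lemma poch_eq_prod (a : ℂ) (n : ℕ) : poch a n = ∏ i ∈ Finset.range n, (a + i) := by
  induction n with
  | zero => simp [poch_zero]
  | succ n ih => rw [poch_succ, ih, Finset.prod_range_succ]

lemma poch_one (n : ℕ) : poch 1 n = n.factorial := by
  induction n with
  | zero => simp [poch_zero]
  | succ n ih => rw [poch_succ, ih, Nat.factorial_succ]; push_cast; ring

lemma add_natCast_ne_zero {a : ℂ} (ha : 0 < a.re) (n : ℕ) : a + n ≠ 0 := by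
  intro h
  have := congrArg Complex.re h
  simp at this
  have : (0 : ℝ) ≤ n := n.cast_nonneg
  linarith

lemma two_mul_natCast_add_ne_zero {a : ℂ} (ha : 0 < a.re) (n : ℕ) : 2 * (n : ℂ) + a ≠ 0 := by
  have := add_natCast_ne_zero ha (2 * n)
  push_cast at this
  rwa [add_comm]

lemma poch_ne_zero {a : ℂ} (ha : 0 < a.re) (n : ℕ) : poch a n ≠ 0 := by
  rw [poch_eq_prod]
  exact Finset.prod_ne_zero_iff.mpr fun i _ => add_natCast_ne_zero ha i

lemma tendsto_norm_natCast_add (a : ℂ) : Tendsto (fun n : ℕ => ‖a + n‖) atTop atTop := by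
  refine tendsto_atTop_mono (f := fun n : ℕ => (n : ℝ) + (-‖a‖)) (fun n => ?_)
    (tendsto_atTop_add_const_right _ _ tendsto_natCast_atTop_atTop)
  have := norm_sub_le (a + n) a
  simp at this
  linarith

lemma tendsto_affine_div_add (p q c : ℂ) :
    Tendsto (fun n : ℕ => (p * n + q) / (c + n)) atTop (𝓝 p) := by
  have h1 : Tendsto (fun n : ℕ => (c + n)⁻¹) atTop (𝓝 0) :=
    tendsto_zero_iff_norm_tendsto_zero.mpr <| by
      simpa [norm_inv, Pi.inv_def] using (tendsto_norm_natCast_add c).inv_tendsto_atTop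
  have h2 : Tendsto (fun n : ℕ => p + (q - p * c) * (c + n)⁻¹) atTop (𝓝 p) := by
    simpa using (h1.const_mul (q - p * c)).const_add p
  refine h2.congr' ?_
  filter_upwards [(tendsto_norm_natCast_add c).eventually_gt_atTop 0] with n hn
  have : c + n ≠ 0 := norm_pos_iff.mp hn
  field_simp
  ring

lemma poch_mul_GammaSeq {a : ℂ} (ha : 0 < a.re) (n : ℕ) :
    poch a n * (a + n) * Complex.GammaSeq a n = (n : ℂ) ^ a * n.factorial := by
  rw [← poch_succ, Complex.GammaSeq, ← poch_eq_prod]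
  field_simp [poch_ne_zero ha (n + 1)]

/-- Euler's limit for Γ, applied to a and to c, gives (a)_n/(c)_n ~ (Γ(c)/Γ(a)) n^(a - c). -/
lemma poch_div_poch_isBigO {a c : ℂ} (ha : 0 < a.re) (hc : 0 < c.re) :
    (fun n : ℕ => poch a n / poch c n) =O[atTop] fun n : ℕ => (n : ℝ) ^ (a.re - c.re) := by
  have hlim : Tendsto (fun n : ℕ => Complex.GammaSeq c n / Complex.GammaSeq a n *
      ((1 * n + c) / (a + n))) atTop (𝓝 (Complex.Gamma c / Complex.Gamma a * 1)) :=
    ((Complex.GammaSeq_tendsto_Gamma c).div (Complex.GammaSeq_tendsto_Gamma a)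
      (Complex.Gamma_ne_zero_of_re_pos ha)).mul (tendsto_affine_div_add 1 c a)
  have hO' : (fun n : ℕ => (Complex.GammaSeq c n / Complex.GammaSeq a n *
      ((1 * n + c) / (a + n))) * (n : ℂ) ^ (a - c)) =O[atTop]
      fun n : ℕ => (n : ℝ) ^ (a.re - c.re) := by
    refine ((hlim.isBigO_one ℝ).mul (g₂ := fun n : ℕ => (n : ℝ) ^ (a.re - c.re)) ?_).trans ?_
    · refine IsBigO.of_bound 1 ?_
      filter_upwards [eventually_gt_atTop 0] with n hn
      rw [Complex.norm_natCast_cpow_of_pos hn, one_mul, Complex.sub_re]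
      exact le_abs_self _
    · simpa using isBigO_refl (fun n : ℕ => (n : ℝ) ^ (a.re - c.re)) atTop
  refine hO'.congr' ?_ EventuallyEq.rfl
  filter_upwards [eventually_gt_atTop 0] with n hn
  have hn0 : (n : ℂ) ≠ 0 := by exact_mod_cast hn.ne'
  have hfac : (n.factorial : ℂ) ≠ 0 := by exact_mod_cast n.factorial_ne_zero
  have key : ∀ b : ℂ, 0 < b.re → Complex.GammaSeq b n ≠ 0 := fun b hb h => by
    have := poch_mul_GammaSeq hb n
    rw [h, mul_zero] at this
    exact (mul_ne_zero (by simp [Complex.cpow_eq_zero_iff, hn0]) hfac) this.symm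
  have h1 := poch_mul_GammaSeq ha n
  have h2 := poch_mul_GammaSeq hc n
  have hGa := key a ha
  have hGc := key c hc
  have hpc := poch_ne_zero hc n
  have han := add_natCast_ne_zero ha n
  have hcn := add_natCast_ne_zero hc n
  have hca : (n : ℂ) ^ c ≠ 0 := by simp [Complex.cpow_eq_zero_iff, hn0]
  rw [Complex.cpow_sub _ _ hn0]
  have e1 : (n : ℂ) ^ a = poch a n * (a + n) * Complex.GammaSeq a n / n.factorial := by
    rw [h1]; field_simp
  have e2 : (n : ℂ) ^ c = poch c n * (c + n) * Complex.GammaSeq c n / n.factorial := by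
    rw [h2]; field_simp
  rw [e1, e2]
  field_simp
  ring

lemma tendsto_poch_div_poch {a c : ℂ} (ha : 0 < a.re) (hac : a.re < c.re) :
    Tendsto (fun n : ℕ => poch a n / poch c n) atTop (𝓝 0) := by
  refine (poch_div_poch_isBigO ha (ha.trans hac)).trans_tendsto ?_
  have := (tendsto_rpow_neg_atTop (sub_pos.mpr hac)).comp
    (tendsto_natCast_atTop_atTop (R := ℝ))
  simpa [Function.comp_def] using this

/-! ### Convergence and bounds for the collapsed hypergeometric series -/

/-- The series `∑ (a)_n / ((c)_n (2 n + d))`. -/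
def pochSum (a c d : ℂ) : ℂ := ∑' n : ℕ, poch a n / (poch c n * (2 * n + d))

lemma summable_pochSum {a c : ℂ} (ha : 0 < a.re) (hac : a.re < c.re) (d : ℂ) :
    Summable fun n : ℕ => poch a n / (poch c n * (2 * n + d)) := by
  have h1 : (fun n : ℕ => (n : ℂ) / (2 * n + d)) =O[atTop] fun _ => (1 : ℝ) := by
    have := (tendsto_affine_div_add (1 / 2) 0 (d / 2)).isBigO_one ℝ
    refine this.congr (fun n => ?_) fun _ => rfl
    rw [show d / 2 + (n : ℂ) = (2 * n + d) / 2 by ring, div_div_eq_mul_div]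
    ring
  have h2 : (fun n : ℕ => ((n : ℂ))⁻¹) =O[atTop] fun n : ℕ => ((n : ℝ))⁻¹ :=
    IsBigO.of_bound 1 (by simp)
  have h3 := ((poch_div_poch_isBigO ha (ha.trans hac)).mul h1).mul h2
  refine summable_of_isBigO_nat (g := fun n : ℕ => (n : ℝ) ^ (a.re - c.re - 1))
    (Real.summable_nat_rpow.mpr (by linarith)) ?_
  refine h3.congr' ?_ ?_
  · filter_upwards [eventually_gt_atTop 0] with n hn
    have hn0 : (n : ℂ) ≠ 0 := by exact_mod_cast hn.ne'
    rw [div_mul_div_comm, mul_comm (poch a n), mul_div_assoc, mul_comm, ← mul_assoc,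
      inv_mul_cancel₀ hn0, one_mul]
  · filter_upwards [eventually_gt_atTop 0] with n hn
    rw [Real.rpow_sub_one (by exact_mod_cast hn.ne'), mul_one, div_eq_mul_inv]

/-- The hypothesis bounds each factor |a + j|/|c + j| by (X + j)/(X + j + 1), and these bounds
multiply to X/(X + n). Unlike the asymptotic estimate, the result is uniform in a and c. -/
lemma norm_poch_div_poch_le {a c : ℂ} {X : ℝ} (hX : 0 < X)
    (h : ∀ j : ℕ, ‖a + j‖ * (X + j + 1) ≤ (X + j) * ‖c + j‖) (hc : 0 < c.re) (n : ℕ) :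
    ‖poch a n / poch c n‖ ≤ X / (X + n) := by
  have hpos : ∀ n : ℕ, 0 < X + n := fun n => by positivity
  induction n with
  | zero => simp [poch_zero, hX.ne']
  | succ n ih =>
    have hcn := norm_pos_iff.mpr (add_natCast_ne_zero hc n)
    have h1 : X + ((n : ℝ) + 1) = X + n + 1 := by ring
    have hstep : ‖(a + n) / (c + n)‖ ≤ (X + n) / (X + n + 1) := by
      rw [norm_div, div_le_div_iff₀ hcn (by have := hpos n; linarith)]
      exact h n
    rw [poch_succ, poch_succ, mul_div_mul_comm, norm_mul]
    calc _ ≤ X / (X + n) * ((X + n) / (X + n + 1)) :=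
          mul_le_mul ih hstep (norm_nonneg _) (div_nonneg hX.le (hpos n).le)
      _ = X / (X + (n + 1 : ℕ)) := by
          have := (hpos n).ne'
          push_cast
          rw [h1]
          field_simp

lemma norm_pochSum_le {a c d : ℂ} {X : ℝ} (hX : 1 / 2 ≤ X)
    (h : ∀ j : ℕ, ‖a + j‖ * (X + j + 1) ≤ (X + j) * ‖c + j‖) (hc : 0 < c.re) (hd : 1 ≤ d.re) :
    ‖pochSum a c d‖ ≤ X * ∑' n : ℕ, 2 * ((n : ℝ) + 1)⁻¹ ^ 2 := by
  have hsum : Summable fun n : ℕ => 2 * ((n : ℝ) + 1)⁻¹ ^ 2 := by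
    have := (summable_nat_add_iff 1).mpr (Real.summable_nat_pow_inv.mpr one_lt_two)
    simpa [inv_pow] using this.mul_left 2
  rw [← tsum_mul_left]
  refine tsum_of_norm_bounded (hsum.mul_left X).hasSum fun n => ?_
  have h1 := norm_poch_div_poch_le (by linarith) h hc n
  have hn : (0 : ℝ) ≤ n := n.cast_nonneg
  have h2 : (n : ℝ) + 1 ≤ ‖2 * (n : ℂ) + d‖ := by
    refine le_trans ?_ (Complex.re_le_norm _)
    simp
    linarith
  rw [← div_div, norm_div]
  calc _ ≤ X / (X + n) / (n + 1) := by gcongr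
    _ ≤ X / ((n + 1) / 2) / (n + 1) := by gcongr; linarith
    _ = _ := by field_simp

lemma hasSum_of_telescoping {E : Type*} [AddCommGroup E] [TopologicalSpace E]
    [IsTopologicalAddGroup E] [T2Space E] {u T : ℕ → E} (hu : Summable u) (h : ∀ n, u n = T n - T (n + 1))
    (hT : Tendsto T atTop (𝓝 0)) : HasSum u (T 0) := by
  have h1 := hu.hasSum.tendsto_sum_nat
  have h2 : Tendsto (fun n => ∑ i ∈ Finset.range n, u i) atTop (𝓝 (T 0)) := by
    simp_rw [h, Finset.sum_range_sub']
    simpa using hT.const_sub (T 0)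
  rw [← tendsto_nhds_unique h1 h2]
  exact hu.hasSum

/-! ### Lerch sums and the shift recurrences -/

/-- The series `∑_{k ≥ 1} z ^ k / (k - s)`. -/
def lerchSum (z s : ℂ) : ℂ := ∑' k : ℕ, z ^ (k + 1) / (((k : ℂ) + 1) - s)

lemma summable_lerchSum {z : ℂ} (hz : ‖z‖ < 1) (s : ℂ) :
    Summable fun k : ℕ => z ^ (k + 1) / (((k : ℂ) + 1) - s) := by
  refine summable_of_isBigO_nat (g := fun k : ℕ => ‖z‖ ^ (k + 1))
    ((summable_nat_add_iff 1).mpr (summable_geometric_of_lt_one (norm_nonneg z) hz)) ?_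
  have h1 := (tendsto_affine_div_add 0 1 (1 - s)).isBigO_one ℝ
  have h2 : (fun k : ℕ => z ^ (k + 1)) =O[atTop] fun k : ℕ => ‖z‖ ^ (k + 1) :=
    IsBigO.of_bound 1 (by simp)
  refine (h2.mul h1).congr (fun k => ?_) fun k => by simp
  rw [zero_mul, zero_add, mul_one_div]
  congr 1
  ring

/-- Split off k = 1 and reindex. This holds even at the poles, where the term with zero denominator
counts as 0 on both sides. -/
lemma lerchSum_step {z : ℂ} (hz : ‖z‖ < 1) (s : ℂ) :
    lerchSum z s = z / (1 - s) + z * lerchSum z (s - 1) := by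
  rw [lerchSum, (summable_lerchSum hz s).tsum_eq_zero_add, lerchSum, ← tsum_mul_left]
  congr 1
  · simp
  · refine tsum_congr fun k => ?_
    push_cast
    rw [mul_div_assoc', pow_succ' z (k + 1)]
    congr 1
    ring

lemma norm_lerchSum_le {z s : ℂ} (hz : ‖z‖ < 1) (hs : s.re ≤ 0) :
    ‖lerchSum z s‖ ≤ ∑' k : ℕ, ‖z‖ ^ (k + 1) := by
  have hsum := (summable_nat_add_iff 1).mpr (summable_geometric_of_lt_one (norm_nonneg z) hz)
  refine tsum_of_norm_bounded hsum.hasSum fun k => ?_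
  rw [norm_div, norm_pow]
  refine div_le_self (by positivity) (le_trans ?_ (Complex.re_le_norm _))
  have : (0 : ℝ) ≤ k := k.cast_nonneg
  simp
  linarith

lemma conj_lerchSum (z s : ℂ) : conj (lerchSum z (conj s)) = lerchSum (conj z) s := by
  simp [lerchSum, Complex.conj_tsum]

lemma norm_one_add_I : ‖1 + Complex.I‖ = √2 := by
  rw [Complex.norm_def]
  simp [Complex.normSq_apply]
  norm_num

lemma sqrt_two_lt_two : √2 < 2 := by
  rw [Real.sqrt_lt' two_pos]
  norm_num

lemma norm_half_one_add_I_lt : ‖(1 + Complex.I) / 2‖ < 1 := by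
  rw [norm_div, norm_one_add_I, Complex.norm_ofNat]
  have := sqrt_two_lt_two
  linarith

lemma norm_quarter_one_add_I_lt : ‖(1 + Complex.I) / 4‖ < 1 := by
  rw [norm_div, norm_one_add_I, Complex.norm_ofNat]
  have := sqrt_two_lt_two
  linarith

lemma norm_neg_half_I_lt : ‖-Complex.I / 2‖ < 1 := by
  rw [norm_div, norm_neg, Complex.norm_I, Complex.norm_ofNat]
  norm_num

lemma norm_half_one_sub_I_lt : ‖(1 - Complex.I) / 2‖ < 1 := by
  have := norm_half_one_add_I_lt
  rw [← Complex.norm_conj] at this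
  simpa [sub_eq_add_neg] using this

lemma norm_quarter_one_sub_I_lt : ‖(1 - Complex.I) / 4‖ < 1 := by
  have := norm_quarter_one_add_I_lt
  rw [← Complex.norm_conj] at this
  simpa [sub_eq_add_neg] using this

lemma norm_half_I_lt : ‖Complex.I / 2‖ < 1 := by
  have := norm_neg_half_I_lt
  rwa [neg_div, norm_neg] at this

lemma genF_eq (t : ℂ) : genF t = 2 * t * lerchSum ((1 + Complex.I) / 2) (2 * t) := rfl

lemma genG_eq (t : ℂ) : genG t =
    2 * t * (lerchSum ((1 + Complex.I) / 4) (2 * t / 3) - lerchSum (-Complex.I / 2) t) := by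
  rw [genG, lerchSum, lerchSum,
    (summable_lerchSum norm_quarter_one_add_I_lt _).tsum_sub (summable_lerchSum norm_neg_half_I_lt _)]

lemma genF_shift (t : ℂ) (ht : ∀ k : ℕ, 2 * t ≠ k) :
    2 * genF t / t - (Complex.I * genF (t - 1) - Complex.I) / (t - 1)
      = (2 + 2 * Complex.I) / (1 - 2 * t) := by
  have h0 : t ≠ 0 := fun h => ht 0 (by simp [h])
  have h1 : t - 1 ≠ 0 := fun h => ht 2 (by rw [sub_eq_zero.mp h]; norm_num)
  have h2 : 1 - 2 * t ≠ 0 := fun h => ht 1 (by rw [← sub_eq_zero.mp h]; norm_num)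
  have h3 : 1 - (2 * t - 1) ≠ 0 := fun h => h1 (by linear_combination (-1 / 2) * h)
  rw [genF_eq, genF_eq, lerchSum_step norm_half_one_add_I_lt (2 * t),
    lerchSum_step norm_half_one_add_I_lt (2 * t - 1),
    show 2 * t - 1 - 1 = 2 * (t - 1) by ring]
  generalize lerchSum _ _ = L
  have hI : Complex.I ^ 2 = -1 := Complex.I_sq
  rw [show 1 - (2 * t - 1) = -(2 * (t - 1)) by ring]
  field_simp
  ring_nf
  simp only [hI]
  ring

/-- Moving t by 3 takes two steps in 2t/3 and three in t, with multipliers ((1+i)/4)^2 = (-i/2)^3 =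
i/8. The common value lets the two sums recombine into `genG (t - 3)`. -/
lemma genG_shift (t : ℂ) (ht : ∀ k : ℕ, t ≠ k ∧ 2 * t ≠ 3 * k) :
    2 ^ 3 * genG t / t - (Complex.I * genG (t - 3) - Complex.I) / (t - 3)
      = (12 + 12 * Complex.I) / (3 - 2 * t) + 8 * Complex.I / (1 - t) + 4 / (2 - t) := by
  have h0 : t ≠ 0 := by simpa using (ht 0).1
  have h1 : 1 - t ≠ 0 := fun h => (ht 1).1 (by rw [← sub_eq_zero.mp h]; norm_num)
  have h2 : 2 - t ≠ 0 := fun h => (ht 2).1 (by rw [← sub_eq_zero.mp h]; norm_num)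
  have h3 : t - 3 ≠ 0 := fun h => (ht 3).1 (by rw [sub_eq_zero.mp h]; norm_num)
  have h4 : 3 - 2 * t ≠ 0 := fun h => (ht 1).2 (by rw [← sub_eq_zero.mp h]; norm_num)
  rw [genG_eq, genG_eq, lerchSum_step norm_quarter_one_add_I_lt (2 * t / 3),
    lerchSum_step norm_quarter_one_add_I_lt (2 * t / 3 - 1),
    lerchSum_step norm_neg_half_I_lt t, lerchSum_step norm_neg_half_I_lt (t - 1),
    lerchSum_step norm_neg_half_I_lt (t - 1 - 1),
    show 2 * t / 3 - 1 - 1 = 2 * (t - 3) / 3 by ring, show t - 1 - 1 - 1 = t - 3 by ring]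
  generalize lerchSum _ _ = L
  generalize lerchSum _ _ = M
  have hI : Complex.I ^ 2 = -1 := Complex.I_sq
  have hI3 : Complex.I ^ 3 = -Complex.I := Complex.I_pow_three
  rw [show 1 - (2 * t / 3 - 1) = -(2 * (t - 3)) / 3 by ring,
    show 1 - 2 * t / 3 = (3 - 2 * t) / 3 by ring, show 1 - (t - 1) = 2 - t by ring,
    show 1 - (t - 1 - 1) = -(t - 3) by ring]
  field_simp
  ring_nf
  simp only [hI, hI3]
  ring

/-! ### Imaginary parts and their recurrences -/

/-- The coefficientwise imaginary part of `genF`, divided by `t`. -/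
def imF (t : ℂ) : ℂ :=
  (lerchSum ((1 + Complex.I) / 2) (2 * t) - lerchSum ((1 - Complex.I) / 2) (2 * t)) / Complex.I

/-- The coefficientwise imaginary part of `genG`, divided by `t`. -/
def imG (t : ℂ) : ℂ :=
  (lerchSum ((1 + Complex.I) / 4) (2 * t / 3) - lerchSum ((1 - Complex.I) / 4) (2 * t / 3)
    - lerchSum (-Complex.I / 2) t + lerchSum (Complex.I / 2) t) / Complex.I

lemma imGen_genF (t : ℂ) : imGen genF t = t * imF t := by
  have h : (2 : ℂ) * conj t = conj (2 * t) := by simp [Complex.conj_ofNat]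
  rw [imGen, genF_eq, genF_eq, map_mul, h, conj_lerchSum, imF]
  simp only [map_mul, map_div₀, map_add, map_one, Complex.conj_I, Complex.conj_ofNat,
    Complex.conj_conj, ← sub_eq_add_neg]
  field_simp

lemma imGen_genG (t : ℂ) : imGen genG t = t * imG t := by
  have h : (2 : ℂ) * conj t / 3 = conj (2 * t / 3) := by simp [Complex.conj_ofNat]
  rw [imGen, genG_eq, genG_eq, map_mul, map_sub, h, conj_lerchSum, conj_lerchSum, imG]
  simp only [map_mul, map_div₀, map_add, map_neg, map_one, Complex.conj_I, Complex.conj_ofNat,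
    Complex.conj_conj, ← sub_eq_add_neg, neg_neg]
  field_simp
  ring

/-- Four steps are taken because ((1 ± i)/2)^4 = -1/4 is real and common to both conjugates. The z^4
pole term therefore drops out. -/
lemma imF_step (t : ℂ) (h3 : 3 - 2 * t ≠ 0) (h1 : 1 - 2 * t ≠ 0) (h2 : 1 - t ≠ 0)
    (h4 : 2 - t ≠ 0) :
    imF t = 1 / (1 - 2 * t) + 1 / (2 * (1 - t)) + 1 / (2 * (3 - 2 * t)) - imF (t - 2) / 4 := by
  have step : ∀ z : ℂ, ‖z‖ < 1 → lerchSum z (2 * t) = z / (1 - 2 * t) + z ^ 2 / (2 * (1 - t))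
      + z ^ 3 / (3 - 2 * t) + z ^ 4 / (2 * (2 - t)) + z ^ 4 * lerchSum z (2 * (t - 2)) := by
    intro z hz
    rw [lerchSum_step hz, lerchSum_step hz (2 * t - 1), lerchSum_step hz (2 * t - 1 - 1),
      lerchSum_step hz (2 * t - 1 - 1 - 1),
      show 2 * t - 1 - 1 - 1 - 1 = 2 * (t - 2) by ring, show 1 - (2 * t - 1) = 2 * (1 - t) by ring,
      show 1 - (2 * t - 1 - 1) = 3 - 2 * t by ring,
      show 1 - (2 * t - 1 - 1 - 1) = 2 * (2 - t) by ring]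
    ring
  rw [imF, step _ norm_half_one_add_I_lt, step _ norm_half_one_sub_I_lt, imF]
  generalize lerchSum _ _ = L
  generalize lerchSum _ _ = M
  have e1 : ((1 + Complex.I) / 2) ^ 2 = Complex.I / 2 := by linear_combination Complex.I_sq / 4
  have e2 : ((1 - Complex.I) / 2) ^ 2 = -Complex.I / 2 := by linear_combination Complex.I_sq / 4
  have hI : Complex.I ≠ 0 := Complex.I_ne_zero
  simp only [pow_succ _ 3, pow_succ _ 2, e1, e2]
  field_simp
  ring_nf
  simp only [Complex.I_sq, Complex.I_pow_three]
  ring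

/-- Here ((1 ± i)/4)^4 = (±i/2)^6 = -1/64, so t moves by 6 with one real multiplier. Pole terms with
a real power of z cancel between conjugates. -/
lemma imG_step (t : ℂ) :
    imG t = 3 / (2 * (3 - 2 * t)) + 3 / (8 * (3 - t)) + 3 / (16 * (9 - 2 * t))
      + 1 / (1 - t) - 1 / (4 * (3 - t)) + 1 / (16 * (5 - t)) - imG (t - 6) / 64 := by
  have step : ∀ z : ℂ, ‖z‖ < 1 → lerchSum z (2 * t / 3) = 3 * z / (3 - 2 * t)
      + 3 * z ^ 2 / (2 * (3 - t)) + 3 * z ^ 3 / (9 - 2 * t) + 3 * z ^ 4 / (2 * (6 - t))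
      + z ^ 4 * lerchSum z (2 * (t - 6) / 3) := by
    intro z hz
    rw [lerchSum_step hz, lerchSum_step hz (2 * t / 3 - 1), lerchSum_step hz (2 * t / 3 - 1 - 1),
      lerchSum_step hz (2 * t / 3 - 1 - 1 - 1),
      show 2 * t / 3 - 1 - 1 - 1 - 1 = 2 * (t - 6) / 3 by ring,
      show 1 - (2 * t / 3 - 1) = 2 * (3 - t) / 3 by ring,
      show 1 - (2 * t / 3 - 1 - 1) = (9 - 2 * t) / 3 by ring,
      show 1 - (2 * t / 3 - 1 - 1 - 1) = 2 * (6 - t) / 3 by ring,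
      show 1 - 2 * t / 3 = (3 - 2 * t) / 3 by ring]
    simp only [div_div_eq_mul_div]
    ring
  have step' : ∀ z : ℂ, ‖z‖ < 1 → lerchSum z t = z / (1 - t)
      + z ^ 2 / (2 - t) + z ^ 3 / (3 - t) + z ^ 4 / (4 - t) + z ^ 5 / (5 - t) + z ^ 6 / (6 - t)
      + z ^ 6 * lerchSum z (t - 6) := by
    intro z hz
    rw [lerchSum_step hz, lerchSum_step hz (t - 1), lerchSum_step hz (t - 1 - 1),
      lerchSum_step hz (t - 1 - 1 - 1), lerchSum_step hz (t - 1 - 1 - 1 - 1),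
      lerchSum_step hz (t - 1 - 1 - 1 - 1 - 1),
      show t - 1 - 1 - 1 - 1 - 1 - 1 = t - 6 by ring, show 1 - (t - 1) = 2 - t by ring,
      show 1 - (t - 1 - 1) = 3 - t by ring, show 1 - (t - 1 - 1 - 1) = 4 - t by ring,
      show 1 - (t - 1 - 1 - 1 - 1) = 5 - t by ring,
      show 1 - (t - 1 - 1 - 1 - 1 - 1) = 6 - t by ring]
    ring
  rw [imG, step _ norm_quarter_one_add_I_lt, step _ norm_quarter_one_sub_I_lt,
    step' _ norm_neg_half_I_lt, step' _ norm_half_I_lt, imG]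
  generalize lerchSum _ _ = L
  generalize lerchSum _ _ = M
  generalize lerchSum _ _ = L'
  generalize lerchSum _ _ = M'
  have hI : Complex.I⁻¹ = -Complex.I := Complex.inv_I
  have hI5 : Complex.I ^ 5 = Complex.I := by rw [pow_succ, Complex.I_pow_four, one_mul]
  have hI6 : Complex.I ^ 6 = -1 := by rw [pow_succ, hI5, Complex.I_mul_I]
  have hI7 : Complex.I ^ 7 = -Complex.I := by rw [pow_succ, hI6, neg_one_mul]
  simp only [div_eq_mul_inv, mul_inv, hI]
  ring_nf
  simp only [Complex.I_sq, Complex.I_pow_three, Complex.I_pow_four, hI5, hI6, hI7]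
  ring

/-- Since x 0 = q^m x m, geometric decay beats linear growth. Linear rather than bounded growth is
allowed because the bound for the second series is proportional to Re a. -/
lemma eq_zero_of_recurrence {x : ℕ → ℂ} {q : ℂ} (hq : ‖q‖ < 1) (h : ∀ m, x m = q * x (m + 1))
    {A B : ℝ} (hb : ∀ᶠ m : ℕ in atTop, ‖x m‖ ≤ A + B * m) : x 0 = 0 := by
  have hpow : ∀ m, x 0 = q ^ m * x m := fun m => by
    induction m with
    | zero => simp
    | succ m ih => rw [ih, h m, pow_succ]; ring
  have hlim : Tendsto (fun m : ℕ => A * ‖q‖ ^ m + B * (m * ‖q‖ ^ m)) atTop (𝓝 0) := by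
    simpa using ((tendsto_pow_atTop_nhds_zero_of_lt_one (norm_nonneg q) hq).const_mul A).add
      ((tendsto_self_mul_const_pow_of_lt_one (norm_nonneg q) hq).const_mul B)
  refine norm_le_zero_iff.mp (ge_of_tendsto hlim ?_)
  filter_upwards [hb] with m hm
  rw [hpow m, norm_mul, norm_pow]
  calc _ ≤ ‖q‖ ^ m * (A + B * m) := by gcongr
    _ = _ := by ring

/-! ### Telescoping recurrences for the hypergeometric series -/

lemma tendsto_affine_mul_poch_div {a c : ℂ} (ha : 0 < a.re) (hac : a.re < c.re) (p q : ℂ) :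
    Tendsto (fun n : ℕ => (p * n + q) * poch a n / poch c (n + 1)) atTop (𝓝 0) := by
  have := (tendsto_poch_div_poch ha hac).mul (tendsto_affine_div_add p q c)
  rw [zero_mul] at this
  refine this.congr fun n => ?_
  rw [poch_succ, div_mul_div_comm, mul_comm (poch a n)]

/-- Term n + 1 of the series at c and term n of the series at c + 2 share the factor 2n + c + 2.
With weight 1/4 the combined numerator is divisible by it, and what remains telescopes. -/
lemma pochSum_half_step {c : ℂ} (hc : 1 / 2 < c.re) :
    pochSum (1 / 2) c c = 1 / c + (1 / (2 * c - 1)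
      + (c / 4 - 1 / 4 - 1 / (2 * c - 1) / 2) / (c + 1 / 2)) / c
      - pochSum (1 / 2) (c + 2) (c + 2) / 4 := by
  -- With a linear numerator αn + α + β in the telescoping term, the quadratic coefficients in n
  -- cancel. The other two give linear equations that determine α and β.
  set α : ℂ := 1 / (2 * c - 1) with hα
  set β : ℂ := (c / 4 - 1 / 4 - α / 2) / (c + 1 / 2) with hβ
  have hhalf : (1 / 2 : ℂ).re = 1 / 2 := by norm_num
  have hhalf' : 0 < (1 / 2 : ℂ).re := by rw [hhalf]; norm_num
  have hc2 : (c + 2).re = c.re + 2 := by simp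
  have hs := summable_pochSum (c := c) hhalf' (by rw [hhalf]; exact hc) c
  have hs2 := summable_pochSum (c := c + 2) hhalf' (by rw [hhalf, hc2]; linarith) (c + 2)
  have hs1 := (summable_nat_add_iff 1).mpr hs
  have hc0 : 0 < c.re := by linarith
  have hcne : c ≠ 0 := by simpa using add_natCast_ne_zero hc0 0
  have hcne1 : c + 1 ≠ 0 := by simpa using add_natCast_ne_zero hc0 1
  have hα' : 2 * c - 1 ≠ 0 := by
    have := add_natCast_ne_zero (a := 2 * c - 1) (by simp; linarith) 0
    simpa using this
  have hβ' : 2 * c + 1 ≠ 0 := by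
    have := add_natCast_ne_zero (a := 2 * c + 1) (by simp; linarith) 0
    simpa using this
  have htel := hasSum_of_telescoping
    (T := fun n : ℕ => (α * n + (α + β)) * poch (1 / 2) n / poch c (n + 1))
    (hs1.add (hs2.div_const 4)) (fun n => ?_)
    (tendsto_affine_mul_poch_div hhalf' (by rw [hhalf]; exact hc) _ _)
  · have e := htel.tsum_eq
    rw [hs1.tsum_add (hs2.div_const 4), tsum_div_const] at e
    have e0 := hs.tsum_eq_zero_add
    rw [← pochSum] at e e0
    rw [e0]
    simp only [poch_zero, poch_succ, Nat.cast_zero, mul_zero, zero_add, add_zero, one_mul,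
      mul_one] at e ⊢
    linear_combination e
  · have hq : poch (c + 2) n ≠ 0 := poch_ne_zero (by rw [hc2]; linarith) n
    have hcn : c + 1 + n ≠ 0 := add_natCast_ne_zero (by simp; linarith) n
    have hd : 2 * (n : ℂ) + c + 2 ≠ 0 := by
      rw [add_assoc]
      exact two_mul_natCast_add_ne_zero (by rw [hc2]; linarith) n
    have e2 : poch c (n + 1 + 1) = c * (c + 1) * poch (c + 2) n := by
      rw [poch_succ_left, poch_succ_left, show c + 1 + 1 = c + 2 by ring]; ring
    have e1 : poch c (n + 1) = c * (c + 1) * poch (c + 2) n / (c + 1 + n) := by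
      rw [← e2, poch_succ c (n + 1), eq_div_iff hcn]; push_cast; ring
    have hd' : 2 * ((n : ℂ) + 1) + c = 2 * n + c + 2 := by ring
    have hd'' : 2 * (n : ℂ) + (c + 2) = 2 * n + c + 2 := by ring
    simp only [e2, e1, poch_succ (1 / 2) n, Nat.cast_add, Nat.cast_one, hd', hd'']
    rw [hβ, hα, show c + 1 / 2 = (2 * c + 1) / 2 by ring]
    field_simp
    ring

/-- Passing from a to a + 2 raises 3a - 1/2 by 6, so term n + 3 is paired with term n. The weight
1/64 makes 2n + 3(a + 2) - 1/2 divide the combined numerator. The explicit fractions are the first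
three terms and the boundary value. -/
lemma pochSum_double_step {a : ℂ} (ha : 0 < a.re) :
    pochSum a (2 * a) (3 * a - 1 / 2) = 1 / (3 * a - 1 / 2) + 1 / (2 * (3 * a + 3 / 2))
      + (a + 1) / (2 * (2 * a + 1) * (3 * a + 7 / 2))
      + (3 / (2 * a) + (6 * a ^ 2 + a - 4) / (8 * a * (a + 1))) / (4 * (2 * a + 1))
      - pochSum (a + 2) (2 * (a + 2)) (3 * (a + 2) - 1 / 2) / 64 := by
  set α : ℂ := 1 / (2 * a) with hα
  set β : ℂ := (6 * a ^ 2 + a - 4) / (8 * a * (a + 1)) with hβ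
  have h2a : (2 * a).re = 2 * a.re := by simp
  have ha2 : (a + 2).re = a.re + 2 := by simp
  have h2a4 : (2 * (a + 2)).re = 2 * a.re + 4 := by simp; ring
  have hs := summable_pochSum (c := 2 * a) ha (by rw [h2a]; linarith) (3 * a - 1 / 2)
  have hs2 := summable_pochSum (a := a + 2) (c := 2 * (a + 2)) (by rw [ha2]; linarith)
    (by rw [ha2, h2a4]; linarith) (3 * (a + 2) - 1 / 2)
  have hs1 := (summable_nat_add_iff 3).mpr hs
  have hane : a ≠ 0 := by simpa using add_natCast_ne_zero ha 0
  have hane1 : a + 1 ≠ 0 := by simpa using add_natCast_ne_zero ha 1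
  have h2ane1 : 2 * a + 1 ≠ 0 := by
    simpa using add_natCast_ne_zero (a := 2 * a) (by rw [h2a]; linarith) 1
  have h2ane3 : 2 * a + 3 ≠ 0 := by
    simpa using add_natCast_ne_zero (a := 2 * a) (by rw [h2a]; linarith) 3
  have hlim : Tendsto (fun n : ℕ => (α * (n + 3 : ℕ) + β) * poch a (n + 2) / poch (2 * a) (n + 3))
      atTop (𝓝 0) := by
    refine ((tendsto_affine_mul_poch_div (c := 2 * a) ha (by rw [h2a]; linarith)
      α (α + β)).comp (tendsto_add_atTop_nat 2)).congr fun n => ?_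
    simp only [Function.comp_apply]
    push_cast
    ring
  have htel := hasSum_of_telescoping (hs1.add (hs2.div_const 64)) (fun n => ?_) hlim
  · have e := htel.tsum_eq
    rw [hs1.tsum_add (hs2.div_const 64), tsum_div_const] at e
    have e0 := hs.sum_add_tsum_nat_add 3
    rw [← pochSum] at e e0
    rw [← e0]
    simp only [Finset.sum_range_succ, Finset.sum_range_zero, poch_zero, poch_succ, Nat.cast_zero,
      mul_zero, zero_add, add_zero, one_mul, mul_one, Nat.cast_one, Nat.cast_ofNat] at e ⊢
    have f1 : a / (2 * a * (2 + (3 * a - 1 / 2))) = 1 / (2 * (3 * a + 3 / 2)) := by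
      rw [show 2 + (3 * a - 1 / 2) = 3 * a + 3 / 2 by ring]
      field_simp
    have f2 : a * (a + 1) / (2 * a * (2 * a + 1) * (2 * 2 + (3 * a - 1 / 2)))
        = (a + 1) / (2 * (2 * a + 1) * (3 * a + 7 / 2)) := by
      rw [show 2 * 2 + (3 * a - 1 / 2) = 3 * a + 7 / 2 by ring]
      field_simp
    have f3 : (α * 3 + β) * (a * (a + 1)) / (2 * a * (2 * a + 1) * (2 * a + 2))
        = (3 / (2 * a) + β) / (4 * (2 * a + 1)) := by
      rw [hα, show 2 * a + 2 = 2 * (a + 1) by ring]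
      field_simp
      ring
    rw [f1, f2]
    norm_num only at e f3
    linear_combination e + f3
  · have hq : poch (2 * (a + 2)) n ≠ 0 := poch_ne_zero (by rw [h2a4]; linarith) n
    have hcn : 2 * a + 3 + n ≠ 0 := add_natCast_ne_zero (by simp; linarith) n
    have hd : 2 * (n : ℂ) + (3 * (a + 2) - 1 / 2) ≠ 0 :=
      two_mul_natCast_add_ne_zero (by simp; linarith) n
    obtain ⟨d, hdd⟩ : ∃ d : ℂ, d = 4 * n + 6 * a + 11 := ⟨_, rfl⟩
    have hd2 : d ≠ 0 := fun h => hd (by linear_combination (h - hdd) / 2)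
    have p2 : poch a (n + 2) = a * (a + 1) * poch (a + 2) n := by
      rw [poch_succ_left, poch_succ_left, show a + 1 + 1 = a + 2 by ring]; ring
    have p3 : poch a (n + 3) = a * (a + 1) * poch (a + 2) n * (a + n + 2) := by
      rw [poch_succ a (n + 2), p2]; push_cast; ring
    have e2 : poch (2 * a) (n + 4) = 4 * a * (2 * a + 1) * (a + 1) * (2 * a + 3)
        * poch (2 * (a + 2)) n := by
      rw [poch_succ_left, poch_succ_left, poch_succ_left, poch_succ_left,
        show 2 * a + 1 + 1 + 1 + 1 = 2 * (a + 2) by ring]; ring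
    have e1 : poch (2 * a) (n + 3) = 4 * a * (2 * a + 1) * (a + 1) * (2 * a + 3)
        * poch (2 * (a + 2)) n / (2 * a + 3 + n) := by
      rw [← e2, poch_succ (2 * a) (n + 3), eq_div_iff hcn]; push_cast; ring
    have hd' : 2 * ((n : ℂ) + 3) + (3 * a - 1 / 2) = d / 2 := by rw [hdd]; ring
    have hd'' : 2 * (n : ℂ) + (3 * (a + 2) - 1 / 2) = d / 2 := by rw [hdd]; ring
    simp only [show n + 1 + 3 = n + 4 by ring, show n + 1 + 2 = n + 3 by ring,
      e2, e1, p2, p3, Nat.cast_add, Nat.cast_ofNat, hd', hd'']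
    rw [hβ, hα]
    obtain ⟨x, hx⟩ : ∃ x : ℂ, x = 2 * a + 1 := ⟨_, rfl⟩
    obtain ⟨y, hy⟩ : ∃ y : ℂ, y = 2 * a + 3 := ⟨_, rfl⟩
    rw [← hx] at h2ane1
    rw [← hy] at h2ane3 hcn
    rw [← hx, ← hy]
    field_simp
    rw [hdd, hx, hy]
    ring

/-! ### Growth to the left and uniqueness -/

lemma exists_norm_imF_le : ∃ A : ℝ, ∀ t : ℂ, t.re ≤ 0 → ‖imF t‖ ≤ A := by
  refine ⟨(∑' k : ℕ, ‖(1 + Complex.I) / 2‖ ^ (k + 1)) + ∑' k : ℕ, ‖(1 - Complex.I) / 2‖ ^ (k + 1),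
    fun t ht => ?_⟩
  have hs : (2 * t).re ≤ 0 := by simp; linarith
  rw [imF, norm_div, Complex.norm_I, div_one]
  exact (norm_sub_le _ _).trans (add_le_add (norm_lerchSum_le norm_half_one_add_I_lt hs)
    (norm_lerchSum_le norm_half_one_sub_I_lt hs))

lemma exists_norm_imG_le : ∃ A : ℝ, ∀ t : ℂ, t.re ≤ 0 → ‖imG t‖ ≤ A := by
  refine ⟨(∑' k : ℕ, ‖(1 + Complex.I) / 4‖ ^ (k + 1)) + (∑' k : ℕ, ‖(1 - Complex.I) / 4‖ ^ (k + 1))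
    + (∑' k : ℕ, ‖-Complex.I / 2‖ ^ (k + 1)) + ∑' k : ℕ, ‖Complex.I / 2‖ ^ (k + 1),
    fun t ht => ?_⟩
  have hs : (2 * t / 3).re ≤ 0 := by
    rw [show 2 * t / 3 = ((2 / 3 : ℝ) : ℂ) * t by push_cast; ring, Complex.re_ofReal_mul]
    linarith
  rw [imG, norm_div, Complex.norm_I, div_one]
  exact (norm_add_le _ _).trans (add_le_add ((norm_sub_le _ _).trans (add_le_add
    ((norm_sub_le _ _).trans (add_le_add (norm_lerchSum_le norm_quarter_one_add_I_lt hs)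
    (norm_lerchSum_le norm_quarter_one_sub_I_lt hs))) (norm_lerchSum_le norm_neg_half_I_lt ht)))
    (norm_lerchSum_le norm_half_I_lt ht))

lemma norm_pochSum_half_le {c d : ℂ} (hc : 3 / 2 ≤ c.re) (hd : 1 ≤ d.re) :
    ‖pochSum (1 / 2) c d‖ ≤ 1 / 2 * ∑' n : ℕ, 2 * ((n : ℝ) + 1)⁻¹ ^ 2 := by
  refine norm_pochSum_le le_rfl (fun j => ?_) (by linarith) hd
  have h1 : ‖(1 / 2 : ℂ) + j‖ = 1 / 2 + j := by
    rw [show (1 / 2 : ℂ) + j = ((1 / 2 + j : ℝ) : ℂ) by push_cast; ring, Complex.norm_real,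
      Real.norm_of_nonneg (by positivity)]
  rw [h1]
  refine mul_le_mul_of_nonneg_left (le_trans ?_ (Complex.re_le_norm _)) (by positivity)
  simp
  linarith

lemma norm_pochSum_double_le {a d : ℂ} (ha : 1 ≤ a.re) (hd : 1 ≤ d.re) :
    ‖pochSum a (2 * a) d‖ ≤ a.re * ∑' n : ℕ, 2 * ((n : ℝ) + 1)⁻¹ ^ 2 := by
  refine norm_pochSum_le (by linarith) (fun j => ?_) (by simp; linarith) hd
  have hj : (0 : ℝ) ≤ j := j.cast_nonneg
  refine abs_le_of_sq_le_sq' ?_ (by positivity) |>.2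
  rw [mul_pow, mul_pow, Complex.sq_norm, Complex.sq_norm, Complex.normSq_apply,
    Complex.normSq_apply]
  simp
  set X := a.re
  set y := a.im
  -- Squaring separates real and imaginary parts: this inequality, which uses X ≥ 1, handles the
  -- real part, and the next one the multiple of y^2.
  have h1 : (X + j + 1) ^ 2 ≤ (2 * X + j) ^ 2 := by
    apply pow_le_pow_left₀ <;> linarith
  have h2 : (X + j + 1) ^ 2 ≤ (2 * (X + j)) ^ 2 := by
    apply pow_le_pow_left₀ <;> linarith
  nlinarith [mul_le_mul_of_nonneg_left h1 (sq_nonneg (X + j)),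
    mul_le_mul_of_nonneg_left h2 (sq_nonneg y)]

theorem imF_eq_pochSum {t : ℂ} (ht : t.re < 1 / 2) :
    imF t = pochSum (1 / 2) (1 - t) (1 - t) := by
  obtain ⟨A, hA⟩ := exists_norm_imF_le
  have hre : ∀ m : ℕ, (t - 2 * m).re = t.re - 2 * m := fun m => by simp
  refine sub_eq_zero.mp ?_
  have key := eq_zero_of_recurrence
    (x := fun m : ℕ => imF (t - 2 * m) - pochSum (1 / 2) (1 - (t - 2 * m)) (1 - (t - 2 * m)))
    (q := -1 / 4) (A := A + 1 / 2 * ∑' n : ℕ, 2 * ((n : ℝ) + 1)⁻¹ ^ 2) (B := 0)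
    (by norm_num) (fun m => ?_) ?_
  · simpa using key
  · have hs : (t - 2 * m).re < 1 / 2 := by
      rw [hre]
      have : (0 : ℝ) ≤ m := m.cast_nonneg
      linarith
    rw [show t - 2 * (m + 1 : ℕ) = t - 2 * m - 2 by push_cast; ring]
    generalize t - 2 * (m : ℂ) = s at hs
    have ne : ∀ a b : ℝ, 0 < b → b / 2 ≤ a → (a : ℂ) - b * s ≠ 0 := fun a b hb hab h => by
      have := congrArg Complex.re h
      simp at this
      nlinarith
    have h1 : 1 - 2 * s ≠ 0 := by simpa using ne 1 2 (by norm_num) (by norm_num)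
    have h2 : 3 - 2 * s ≠ 0 := by simpa using ne 3 2 (by norm_num) (by norm_num)
    have h3 : 1 - s ≠ 0 := by simpa using ne 1 1 (by norm_num) (by norm_num)
    have h4 : 2 - s ≠ 0 := by simpa using ne 2 1 (by norm_num) (by norm_num)
    rw [imF_step s h2 h1 h3 h4, pochSum_half_step (c := 1 - s) (by simp; linarith),
      show 1 - s + 2 = 1 - (s - 2) by ring, show 2 * (1 - s) - 1 = 1 - 2 * s by ring,
      show 1 - s + 1 / 2 = (3 - 2 * s) / 2 by ring]
    generalize pochSum _ _ _ = p
    generalize imF (s - 2) = q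
    have : 1 / (1 - 2 * s) + 1 / (2 * (1 - s)) + 1 / (2 * (3 - 2 * s))
        = 1 / (1 - s) + (1 / (1 - 2 * s)
          + ((1 - s) / 4 - 1 / 4 - 1 / (1 - 2 * s) / 2) / ((3 - 2 * s) / 2)) / (1 - s) := by
      field_simp
      ring
    linear_combination this
  · filter_upwards [eventually_ge_atTop 1] with m hm
    have hm' : (1 : ℝ) ≤ m := by exact_mod_cast hm
    rw [zero_mul, add_zero]
    refine (norm_sub_le _ _).trans (add_le_add (hA _ ?_) (norm_pochSum_half_le ?_ ?_))
    · rw [hre]; linarith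
    · rw [Complex.sub_re, hre, Complex.one_re]; linarith
    · rw [Complex.sub_re, hre, Complex.one_re]; linarith

theorem imG_eq_pochSum {t : ℂ} (ht : t.re < 3 / 2) (ht1 : t ≠ 1) :
    imG t = pochSum (1 / 2 - t / 3) (1 - 2 * t / 3) (1 - t) := by
  obtain ⟨A, hA⟩ := exists_norm_imG_le
  -- In terms of a the parameters are a, 2a and 3a - 1/2, the half-plane is Re a > 0, and t - 6
  -- corresponds to a + 2.
  obtain ⟨a, rfl⟩ : ∃ a : ℂ, t = 3 / 2 - 3 * a := ⟨1 / 2 - t / 3, by ring⟩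
  have ha : 0 < a.re := by
    simp at ht
    linarith
  have hre : ∀ m : ℕ, (a + 2 * m).re = a.re + 2 * m := fun m => by simp
  rw [show 1 / 2 - (3 / 2 - 3 * a) / 3 = a by ring, show 1 - 2 * (3 / 2 - 3 * a) / 3 = 2 * a by ring,
    show 1 - (3 / 2 - 3 * a) = 3 * a - 1 / 2 by ring]
  refine sub_eq_zero.mp ?_
  set K : ℝ := ∑' n : ℕ, 2 * ((n : ℝ) + 1)⁻¹ ^ 2 with hK
  have key := eq_zero_of_recurrence
    (x := fun m : ℕ => imG (3 / 2 - 3 * (a + 2 * m))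
      - pochSum (a + 2 * m) (2 * (a + 2 * m)) (3 * (a + 2 * m) - 1 / 2))
    (q := -1 / 64) (A := A + a.re * K) (B := 2 * K) (by norm_num) (fun m => ?_) ?_
  · simpa using key
  · have hs : 0 < (a + 2 * m).re := by
      rw [hre]
      positivity
    have hs1 : 6 * (a + 2 * m) - 1 ≠ 0 := by
      rcases Nat.eq_zero_or_pos m with rfl | hm
      · intro h
        apply ht1
        simp at h
        linear_combination (-1 / 2) * h
      · intro h
        have := congrArg Complex.re h
        have hm' : (1 : ℝ) ≤ m := by exact_mod_cast hm
        simp at this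
        linarith
    rw [show a + 2 * (m + 1 : ℕ) = a + 2 * m + 2 by push_cast; ring]
    generalize a + 2 * (m : ℂ) = s at hs hs1
    have ne : ∀ x y : ℝ, 0 < x → 0 ≤ y → x * s + y ≠ 0 := fun x y hx hy h => by
      have := congrArg Complex.re h
      simp at this
      nlinarith
    have h0 : s ≠ 0 := by simpa using ne 1 0 (by norm_num) (by norm_num)
    have h1 : s + 1 ≠ 0 := by simpa using ne 1 1 (by norm_num) (by norm_num)
    have h2 : 2 * s + 1 ≠ 0 := by simpa using ne 2 1 (by norm_num) (by norm_num)
    have h3 : 6 * s + 7 ≠ 0 := by simpa using ne 6 7 (by norm_num) (by norm_num)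
    rw [imG_step, pochSum_double_step hs,
      show 3 / 2 - 3 * s - 6 = 3 / 2 - 3 * (s + 2) by ring]
    generalize pochSum _ _ _ = p
    generalize imG _ = q
    have : 3 / (2 * (3 - 2 * (3 / 2 - 3 * s))) + 3 / (8 * (3 - (3 / 2 - 3 * s)))
        + 3 / (16 * (9 - 2 * (3 / 2 - 3 * s))) + 1 / (1 - (3 / 2 - 3 * s))
        - 1 / (4 * (3 - (3 / 2 - 3 * s))) + 1 / (16 * (5 - (3 / 2 - 3 * s)))
        = 1 / (3 * s - 1 / 2) + 1 / (2 * (3 * s + 3 / 2))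
        + (s + 1) / (2 * (2 * s + 1) * (3 * s + 7 / 2))
        + (3 / (2 * s) + (6 * s ^ 2 + s - 4) / (8 * s * (s + 1))) / (4 * (2 * s + 1)) := by
      rw [show 3 - 2 * (3 / 2 - 3 * s) = 6 * s by ring,
        show 3 - (3 / 2 - 3 * s) = 3 * (2 * s + 1) / 2 by ring,
        show 9 - 2 * (3 / 2 - 3 * s) = 6 * (s + 1) by ring,
        show 1 - (3 / 2 - 3 * s) = 3 * s - 1 / 2 by ring,
        show 5 - (3 / 2 - 3 * s) = (6 * s + 7) / 2 by ring,
        show 3 * s + 3 / 2 = 3 * (2 * s + 1) / 2 by ring,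
        show 3 * s + 7 / 2 = (6 * s + 7) / 2 by ring]
      -- The pole 1/(1 - t) occurs identically on both sides, so it can be treated as an unknown.
      generalize 1 / (3 * s - 1 / 2) = e
      field_simp
      ring
    linear_combination this
  · filter_upwards [eventually_ge_atTop 1] with m hm
    have hm' : (1 : ℝ) ≤ m := by exact_mod_cast hm
    have hre3 : (3 * (a + 2 * m)).re = 3 * (a.re + 2 * m) := by simp
    refine (norm_sub_le _ _).trans ((add_le_add (hA _ ?_) (norm_pochSum_double_le ?_ ?_)).trans ?_)
    · rw [Complex.sub_re, hre3]; norm_num; linarith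
    · rw [hre]; linarith
    · rw [Complex.sub_re, hre3]; norm_num; linarith
    · rw [hre, ← hK]; linarith

/-! ### Reduction of the 3F2 series -/

/-- The ratio (a)_n/(a + 1)_n equals a/(a + n), and (1)_n cancels n!. -/
lemma hyp3F2Term_eq {a b e : ℂ} (ha : a ≠ 0) (ha1 : 0 < (a + 1).re) (n : ℕ) :
    hyp3F2Term a b 1 (a + 1) e 1 n = 2 * a * (poch b n / (poch e n * (2 * n + 2 * a))) := by
  have hn : a + n ≠ 0 := by
    rcases n with _ | n
    · simpa using ha
    · have := add_natCast_ne_zero ha1 n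
      push_cast
      rwa [add_comm (n : ℂ), ← add_assoc]
  have h1 : poch a n = a * poch (a + 1) n / (a + n) := by
    rw [eq_div_iff hn, ← poch_succ, poch_succ_left]
  have hp := poch_ne_zero ha1 n
  have hf : (n.factorial : ℂ) ≠ 0 := by exact_mod_cast n.factorial_ne_zero
  rw [hyp3F2Term, ← poch, ← poch, ← poch, ← poch, ← poch, poch_one, h1, one_pow,
    show 2 * (n : ℂ) + 2 * a = 2 * (a + n) by ring]
  -- If (e)_n = 0, both sides are 0 by the convention for division by zero.
  rcases eq_or_ne (poch e n) 0 with h | h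
  · simp [h]
  · field_simp

lemma summable_hyp3F2Term {a b e : ℂ} (ha : a ≠ 0) (ha1 : 0 < (a + 1).re) (hb : 0 < b.re)
    (hbe : b.re < e.re) : Summable (hyp3F2Term a b 1 (a + 1) e 1) := by
  rw [funext (hyp3F2Term_eq ha ha1)]
  exact (summable_pochSum hb hbe _).mul_left _

lemma hyp3F2_eq {a b e : ℂ} (ha : a ≠ 0) (ha1 : 0 < (a + 1).re) :
    hyp3F2 a b 1 (a + 1) e 1 = 2 * a * pochSum b e (2 * a) := by
  rw [hyp3F2, funext (hyp3F2Term_eq ha ha1), tsum_mul_left, pochSum]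

theorem imGen_genF_eq {t : ℂ} (ht : t.re < 1 / 2) :
    Summable (hyp3F2Term (1 / 2 - t / 2) (1 / 2) 1 (3 / 2 - t / 2) (1 - t) 1) ∧
      imGen genF t
        = t * (1 - t)⁻¹ * hyp3F2 (1 / 2 - t / 2) (1 / 2) 1 (3 / 2 - t / 2) (1 - t) 1 := by
  have h1 : 1 - t ≠ 0 := fun h => by
    rw [← sub_eq_zero.mp h] at ht
    norm_num at ht
  have ha : 1 / 2 - t / 2 ≠ 0 := fun h => h1 (by linear_combination 2 * h)
  have hdiv : (t / 2).re = t.re / 2 := by simp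
  have ha1 : 0 < (1 / 2 - t / 2 + 1).re := by
    rw [Complex.add_re, Complex.sub_re, hdiv]
    norm_num
    linarith
  rw [show 3 / 2 - t / 2 = 1 / 2 - t / 2 + 1 by ring]
  refine ⟨summable_hyp3F2Term ha ha1 (by norm_num) ?_, ?_⟩
  · rw [Complex.sub_re]
    norm_num
    linarith
  · rw [hyp3F2_eq ha ha1, imGen_genF, imF_eq_pochSum ht,
      show 2 * (1 / 2 - t / 2) = 1 - t by ring]
    field_simp

theorem imGen_genG_eq {t : ℂ} (ht : t.re < 3 / 2) (ht1 : t ≠ 1) :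
    Summable (hyp3F2Term (1 / 2 - t / 2) (1 / 2 - t / 3) 1 (3 / 2 - t / 2) (1 - 2 * t / 3) 1) ∧
      imGen genG t = t * (1 - t)⁻¹ *
        hyp3F2 (1 / 2 - t / 2) (1 / 2 - t / 3) 1 (3 / 2 - t / 2) (1 - 2 * t / 3) 1 := by
  have h1 : 1 - t ≠ 0 := fun h => ht1 (sub_eq_zero.mp h).symm
  have ha : 1 / 2 - t / 2 ≠ 0 := fun h => h1 (by linear_combination 2 * h)
  have hdiv : (t / 2).re = t.re / 2 := by simp
  have hdiv3 : (t / 3).re = t.re / 3 := by simp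
  have ha1 : 0 < (1 / 2 - t / 2 + 1).re := by
    rw [Complex.add_re, Complex.sub_re, hdiv]
    norm_num
    linarith
  have hb : (1 / 2 - t / 3).re = 1 / 2 - t.re / 3 := by
    rw [Complex.sub_re, hdiv3]
    norm_num
  rw [show 3 / 2 - t / 2 = 1 / 2 - t / 2 + 1 by ring]
  refine ⟨summable_hyp3F2Term ha ha1 (by rw [hb]; linarith) ?_, ?_⟩
  · rw [hb, mul_div_assoc, Complex.sub_re, Complex.mul_re, hdiv3]
    norm_num
    linarith
  · rw [hyp3F2_eq ha ha1, imGen_genG, imG_eq_pochSum ht ht1,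
      show 2 * (1 / 2 - t / 2) = 1 - t by ring]
    field_simp

/-! ### Power series at the origin -/

lemma hasSum_congr {E : Type*} [AddCommMonoid E] [TopologicalSpace E] {f g : ℕ → E} {a : E}
    (h : ∀ n, f n = g n) : HasSum f a ↔ HasSum g a := by
  rw [funext h]

/-- Expand 1/(k - s) as a geometric series in s/k and exchange sums. The double series is dominated
by |s|^n |z|^k. -/
lemma hasSum_pow_mul_polylog {z s : ℂ} (hz : ‖z‖ < 1) (hs : ‖s‖ < 1) :
    HasSum (fun n : ℕ => s ^ n * polylog (n + 1) z) (lerchSum z s) := by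
  let f : ℕ × ℕ → ℂ := fun p => s ^ p.1 * (z ^ (p.2 + 1) / ((p.2 : ℂ) + 1) ^ (p.1 + 1))
  have hone : ∀ k : ℕ, 1 ≤ ‖(k : ℂ) + 1‖ := fun k => by
    rw [show (k : ℂ) + 1 = ((k + 1 : ℕ) : ℂ) by push_cast; ring, Complex.norm_natCast]
    simp
  have hf : Summable f := by
    have h1 := summable_geometric_of_lt_one (norm_nonneg s) hs
    have h2 := (summable_nat_add_iff 1).mpr (summable_geometric_of_lt_one (norm_nonneg z) hz)
    refine Summable.of_norm_bounded (h1.mul_of_nonneg h2 (fun n => by positivity)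
      (fun n => by positivity)) fun p => ?_
    rw [norm_mul, norm_div, norm_pow, norm_pow, norm_pow]
    gcongr
    exact div_le_self (by positivity) (one_le_pow₀ (hone _))
  have houter := hf.hasSum.prod_fiberwise fun n => (hf.prod_factor n).hasSum
  have hval : ∑' p, f p = lerchSum z s := by
    have hswap : Summable fun p : ℕ × ℕ => f p.swap := (Equiv.prodComm ℕ ℕ).summable_iff.mpr hf
    rw [← (Equiv.prodComm ℕ ℕ).tsum_eq f]
    simp only [Equiv.prodComm_apply]
    rw [hswap.tsum_prod, lerchSum]
    refine tsum_congr fun k => ?_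
    have hk : (k : ℂ) + 1 ≠ 0 := norm_pos_iff.mp (by linarith [hone k])
    have hr : ‖s / ((k : ℂ) + 1)‖ < 1 := by
      rw [norm_div]
      exact (div_le_self (norm_nonneg _) (hone k)).trans_lt hs
    have hks : (k : ℂ) + 1 - s ≠ 0 := fun h => by
      have := hone k
      rw [sub_eq_zero.mp h] at this
      linarith
    have hg := (hasSum_geometric_of_norm_lt_one hr).mul_left (z ^ (k + 1) / ((k : ℂ) + 1))
    convert hg.tsum_eq using 1
    · refine tsum_congr fun n => ?_
      simp only [f, Prod.swap_prod_mk, div_pow, pow_succ]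
      field_simp
    · rw [one_sub_div hk, inv_div]
      field_simp
  rw [hval] at houter
  refine (hasSum_congr fun n => ?_).mpr houter
  simp only [f, polylog, tsum_mul_left]

lemma B_add_F (n : ℕ) : (B (n + 1) : ℂ) + Complex.I * F (n + 1)
    = 2 ^ n * polylog (n + 1) ((1 + Complex.I) / 2) := by
  rw [B, F, mul_comm Complex.I, Complex.re_add_im]
  simp

lemma D_add_G (n : ℕ) : (D (n + 1) : ℂ) + Complex.I * G (n + 1)
    = (2 / 3) ^ n * polylog (n + 1) ((1 + Complex.I) / 4) - polylog (n + 1) (-Complex.I / 2) := by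
  rw [D, G, mul_comm Complex.I, Complex.re_add_im]
  simp

theorem hasSum_genF {t : ℂ} (ht : ‖t‖ < 1 / 2) :
    HasSum (fun n : ℕ => 2 * ((B (n + 1) : ℂ) + Complex.I * (F (n + 1) : ℂ)) * t ^ (n + 1))
      (genF t) := by
  have hs : ‖2 * t‖ < 1 := by
    rw [norm_mul, Complex.norm_ofNat]
    linarith
  rw [genF_eq]
  refine (hasSum_congr fun n => ?_).mpr
    ((hasSum_pow_mul_polylog norm_half_one_add_I_lt hs).mul_left (2 * t))
  rw [B_add_F, mul_pow]
  ring

theorem hasSum_genG {t : ℂ} (ht : ‖t‖ < 1) :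
    HasSum (fun n : ℕ => 2 * ((D (n + 1) : ℂ) + Complex.I * (G (n + 1) : ℂ)) * t ^ (n + 1))
      (genG t) := by
  have hs : ‖2 * t / 3‖ < 1 := by
    rw [norm_div, norm_mul, Complex.norm_ofNat, Complex.norm_ofNat]
    linarith [norm_nonneg t]
  rw [genG_eq]
  refine (hasSum_congr fun n => ?_).mpr (((hasSum_pow_mul_polylog norm_quarter_one_add_I_lt hs).sub
    (hasSum_pow_mul_polylog norm_neg_half_I_lt ht)).mul_left (2 * t))
  rw [D_add_G, mul_div_right_comm, mul_pow]
  ring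

lemma hasSum_imGen {b f : ℕ → ℝ} {g : ℂ → ℂ} {t : ℂ}
    (h : HasSum (fun n : ℕ => 2 * ((b n : ℂ) + Complex.I * (f n : ℂ)) * t ^ (n + 1)) (g t))
    (h' : HasSum (fun n : ℕ => 2 * ((b n : ℂ) + Complex.I * (f n : ℂ)) * (conj t) ^ (n + 1))
      (g (conj t))) :
    HasSum (fun n : ℕ => 2 * (f n : ℂ) * t ^ (n + 1)) (imGen g t) := by
  refine (hasSum_congr fun n => ?_).mpr
    ((h.sub (h'.map (starRingEnd ℂ) Complex.continuous_conj)).div_const (2 * Complex.I))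
  have hI := Complex.I_ne_zero
  simp only [Function.comp_apply, map_mul, map_add, map_pow, Complex.conj_ofReal, Complex.conj_I,
    Complex.conj_conj, Complex.conj_ofNat]
  field_simp
  ring

theorem hasSum_F {t : ℂ} (ht : ‖t‖ < 1 / 2) :
    HasSum (fun n : ℕ => 2 * (F (n + 1) : ℂ) * t ^ (n + 1)) (imGen genF t) :=
  hasSum_imGen (b := fun n => B (n + 1)) (f := fun n => F (n + 1)) (hasSum_genF ht)
    (hasSum_genF (by rwa [Complex.norm_conj]))

theorem hasSum_G {t : ℂ} (ht : ‖t‖ < 1) :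
    HasSum (fun n : ℕ => 2 * (G (n + 1) : ℂ) * t ^ (n + 1)) (imGen genG t) :=
  hasSum_imGen (b := fun n => D (n + 1)) (f := fun n => G (n + 1)) (hasSum_genG ht)
    (hasSum_genG (by rwa [Complex.norm_conj]))

/-! ### The terms of order one -/

lemma polylog_one (z : ℂ) : polylog 1 z = lerchSum z 0 := by
  simp [polylog, lerchSum]

lemma sub_conj_div_I (z : ℂ) : (z - conj z) / Complex.I = 2 * (z.im : ℂ) := by
  rw [Complex.sub_conj]
  have := Complex.I_ne_zero
  field_simp
  push_cast
  ring

lemma imF_zero : imF 0 = 2 * (F 1 : ℂ) := by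
  have h := conj_lerchSum ((1 + Complex.I) / 2) 0
  rw [map_zero] at h
  have hc : conj ((1 + Complex.I) / 2) = (1 - Complex.I) / 2 := by
    simp [sub_eq_add_neg, Complex.conj_ofNat]
  rw [hc] at h
  rw [imF, mul_zero, ← h, sub_conj_div_I, F, polylog_one]
  simp

lemma imG_zero : imG 0 = 2 * (G 1 : ℂ) := by
  have h := conj_lerchSum ((1 + Complex.I) / 4) 0
  have h' := conj_lerchSum (-Complex.I / 2) 0
  rw [map_zero] at h h'
  have hc : conj ((1 + Complex.I) / 4) = (1 - Complex.I) / 4 := by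
    simp [sub_eq_add_neg, Complex.conj_ofNat]
  have hc' : conj (-Complex.I / 2) = Complex.I / 2 := by
    simp [Complex.conj_ofNat]
  rw [hc] at h
  rw [hc'] at h'
  rw [imG, mul_zero, zero_div, ← h, ← h', G, polylog_one, polylog_one, ← sub_conj_div_I, map_sub,
    map_mul]
  simp
  ring

lemma arg_half_one_sub_I : Complex.arg ((1 - Complex.I) / 2) = -(Real.pi / 4) := by
  have h : (1 - Complex.I) / 2 = ((√2 / 2 : ℝ) : ℂ) * (Complex.cos ((-(Real.pi / 4) : ℝ) : ℂ)
      + Complex.sin ((-(Real.pi / 4) : ℝ) : ℂ) * Complex.I) := by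
    rw [← Complex.ofReal_cos, ← Complex.ofReal_sin, Real.cos_neg, Real.sin_neg, Real.cos_pi_div_four,
      Real.sin_pi_div_four]
    have : ((√2 : ℝ) : ℂ) ^ 2 = 2 := by
      rw [← Complex.ofReal_pow, Real.sq_sqrt zero_le_two]
      simp
    push_cast
    linear_combination (-(1 - Complex.I) / 4) * this
  rw [h]
  have := Real.pi_pos
  exact Complex.arg_mul_cos_add_sin_mul_I (by positivity) ⟨by linarith, by linarith⟩

lemma F_one : F 1 = Real.pi / 4 := by
  have h := (hasSum_nat_add_iff' 1).mpr
    (Complex.hasSum_taylorSeries_neg_log norm_half_one_add_I_lt)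
  have h2 : polylog 1 ((1 + Complex.I) / 2) = -Complex.log ((1 - Complex.I) / 2) := by
    rw [polylog, show (1 - Complex.I) / 2 = 1 - (1 + Complex.I) / 2 by ring]
    simpa using h.tsum_eq
  rw [F, h2]
  simp [Complex.log_im, arg_half_one_sub_I]

/-- The hypergeometric form at t = 0 transfers the value of F_1, an argument of a complex logarithm,
to the series. -/
lemma pochSum_half_one_one : pochSum (1 / 2) 1 1 = ((Real.pi / 2 : ℝ) : ℂ) := by
  have h := imF_eq_pochSum (t := 0) (by norm_num)
  rw [imF_zero, F_one] at h
  rw [sub_zero] at h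
  rw [← h]
  push_cast
  ring

/-- At t = 0 both hypergeometric forms reduce to the same series. -/
lemma two_mul_G_one : 2 * G 1 = Real.pi / 2 := by
  have h := imG_eq_pochSum (t := 0) (by norm_num) (by norm_num)
  rw [imG_zero] at h
  norm_num only [mul_zero, zero_div, sub_zero] at h
  rw [pochSum_half_one_one] at h
  exact_mod_cast h

/-! ### Wallis-type series -/

/-- The normalized central binomial coefficient `binom (2 n) n / 4 ^ n`. -/
def cbin (n : ℕ) : ℝ := n.centralBinom / 4 ^ n

lemma cbin_zero : cbin 0 = 1 := by simp [cbin]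

lemma cbin_pos (n : ℕ) : 0 < cbin n := by
  have := n.centralBinom_pos
  rw [cbin]
  positivity

lemma cbin_succ (n : ℕ) : cbin (n + 1) = cbin n * (2 * n + 1) / (2 * n + 2) := by
  have h : ((n : ℝ) + 1) * (n + 1).centralBinom = 2 * (2 * n + 1) * n.centralBinom := by
    exact_mod_cast n.succ_mul_centralBinom_succ
  rw [cbin, cbin, pow_succ, div_mul_eq_mul_div, div_div, div_eq_div_iff (by positivity)
    (by positivity)]
  linear_combination 2 * 4 ^ n * h

lemma cbin_eq_poch (n : ℕ) : (cbin n : ℂ) = poch (1 / 2) n / poch 1 n := by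
  induction n with
  | zero => simp [cbin_zero, poch_zero]
  | succ n ih =>
    have h1 : (1 : ℂ) + n ≠ 0 := add_natCast_ne_zero (by norm_num) n
    have h2 := poch_ne_zero (a := 1) (by norm_num) n
    rw [cbin_succ, poch_succ, poch_succ]
    push_cast
    rw [ih, show 2 * (n : ℂ) + 2 = 2 * (1 + n) by ring]
    field_simp
    ring

lemma tendsto_cbin : Tendsto cbin atTop (𝓝 0) := by
  have h := tendsto_poch_div_poch (a := 1 / 2) (c := 1) (by norm_num) (by norm_num)
  simp_rw [← cbin_eq_poch] at h
  simpa [Function.comp_def] using (Complex.continuous_re.tendsto 0).comp h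

lemma cbin_div_eq (n : ℕ) (x : ℝ) : ((cbin n / (2 * n + 1 + x) : ℝ) : ℂ)
    = poch (1 / 2) n / (poch 1 n * (2 * n + (1 + x))) := by
  push_cast
  rw [cbin_eq_poch, div_div, add_assoc]

lemma summable_cbin_div (x : ℝ) : Summable fun n : ℕ => cbin n / (2 * n + 1 + x) := by
  have h := summable_pochSum (a := 1 / 2) (c := 1) (by norm_num) (by norm_num) (1 + x)
  simp_rw [← cbin_div_eq] at h
  exact Complex.summable_ofReal.mp h

lemma summable_cbin_div_sq {x : ℝ} (hx : 0 ≤ x) :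
    Summable fun n : ℕ => cbin n / (2 * n + 1 + x) ^ 2 := by
  refine Summable.of_nonneg_of_le (fun n => ?_) (fun n => ?_) (summable_cbin_div x)
  · have := cbin_pos n
    positivity
  · have := cbin_pos n
    have hn : (0 : ℝ) ≤ n := n.cast_nonneg
    exact div_le_div_of_nonneg_left this.le (by positivity)
      (le_self_pow₀ (by linarith) two_ne_zero)

/-- The Wallis-type series `∑ cbin n / (2 n + 1 + x)`. -/
def wallis (x : ℝ) : ℝ := ∑' n : ℕ, cbin n / (2 * n + 1 + x)

/-- The series `∑ cbin n / (2 n + 1 + x) ^ 2`. -/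
def wallisSq (x : ℝ) : ℝ := ∑' n : ℕ, cbin n / (2 * n + 1 + x) ^ 2

lemma hasSum_wallis (x : ℝ) : HasSum (fun n : ℕ => cbin n / (2 * n + 1 + x)) (wallis x) :=
  (summable_cbin_div x).hasSum

lemma hasSum_wallisSq {x : ℝ} (hx : 0 ≤ x) :
    HasSum (fun n : ℕ => cbin n / (2 * n + 1 + x) ^ 2) (wallisSq x) :=
  (summable_cbin_div_sq hx).hasSum

lemma wallis_pos {x : ℝ} (hx : 0 ≤ x) : 0 < wallis x :=
  (summable_cbin_div x).tsum_pos (fun n => by have := cbin_pos n; positivity) 0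
    (by have := cbin_pos 0; positivity)

lemma wallisSq_nonneg {x : ℝ} (hx : 0 ≤ x) : 0 ≤ wallisSq x :=
  tsum_nonneg fun n => by have := cbin_pos n; positivity

lemma wallisSq_le {x : ℝ} (hx : 0 ≤ x) : wallisSq x ≤ wallis x / (x + 1) := by
  refine hasSum_le (fun n => ?_) (hasSum_wallisSq hx) ((hasSum_wallis x).div_const (x + 1))
  have := cbin_pos n
  have hn : (0 : ℝ) ≤ n := n.cast_nonneg
  rw [div_div]
  apply div_le_div_of_nonneg_left this.le (by positivity)
  rw [sq]
  exact mul_le_mul_of_nonneg_left (by linarith) (by positivity)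

lemma tendsto_mul_cbin_div {x : ℝ} (hx : 0 ≤ x) :
    Tendsto (fun n : ℕ => 2 * n * cbin n / (2 * n + 1 + x)) atTop (𝓝 0) := by
  refine squeeze_zero (fun n => ?_) (fun n => ?_) tendsto_cbin
  · have := cbin_pos n
    positivity
  · have := cbin_pos n
    rw [div_le_iff₀ (by positivity)]
    nlinarith

lemma tendsto_mul_cbin_div_sq {x : ℝ} (hx : 0 ≤ x) :
    Tendsto (fun n : ℕ => 2 * n * cbin n / (2 * n + 1 + x) ^ 2) atTop (𝓝 0) := by
  refine squeeze_zero (fun n => ?_) (fun n => ?_) (tendsto_mul_cbin_div hx)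
  · have := cbin_pos n
    positivity
  · have := cbin_pos n
    have hn : (0 : ℝ) ≤ n := n.cast_nonneg
    exact div_le_div_of_nonneg_left (by positivity) (by positivity)
      (le_self_pow₀ (by linarith) two_ne_zero)

/-- The series form of the reduction formula for the integral of sin^x; the difference of the two
sides telescopes. -/
lemma wallis_add_two {x : ℝ} (hx : 0 ≤ x) : (x + 1) * wallis x = (x + 2) * wallis (x + 2) := by
  have h := ((hasSum_wallis x).mul_left (x + 1)).sub ((hasSum_wallis (x + 2)).mul_left (x + 2))
  have ht := hasSum_of_telescoping (T := fun n : ℕ => -(2 * n * cbin n / (2 * n + 1 + x)))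
    h.summable (fun n => ?_) (by simpa using (tendsto_mul_cbin_div hx).neg)
  · have := h.unique ht
    simp at this
    linarith
  · have h1 : 2 * (n : ℝ) + 1 + x ≠ 0 := by positivity
    have h2 : 2 * (n : ℝ) + 3 + x ≠ 0 := by positivity
    have h3 : 2 * (n : ℝ) + 2 ≠ 0 := by positivity
    rw [cbin_succ]
    push_cast
    rw [show 2 * (n : ℝ) + 1 + (x + 2) = 2 * n + 3 + x by ring,
      show 2 * ((n : ℝ) + 1) + 1 + x = 2 * n + 3 + x by ring]
    field_simp
    ring

/-- The x-derivative of the Wallis recurrence, `wallisSq` being minus the derivative of `wallis`;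
proved by its own telescoping. -/
lemma wallisSq_add_two {x : ℝ} (hx : 0 ≤ x) : wallis x - (x + 1) * wallisSq x
    = wallis (x + 2) - (x + 2) * wallisSq (x + 2) := by
  have hx2 : 0 ≤ x + 2 := by linarith
  have h := ((hasSum_wallis x).sub ((hasSum_wallisSq hx).mul_left (x + 1))).sub
    ((hasSum_wallis (x + 2)).sub ((hasSum_wallisSq hx2).mul_left (x + 2)))
  have ht := hasSum_of_telescoping (T := fun n : ℕ => 2 * n * cbin n / (2 * n + 1 + x) ^ 2)
    h.summable (fun n => ?_) (tendsto_mul_cbin_div_sq hx)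
  · have := h.unique ht
    simp at this
    linarith
  · have h1 : 2 * (n : ℝ) + 1 + x ≠ 0 := by positivity
    have h2 : 2 * (n : ℝ) + 3 + x ≠ 0 := by positivity
    have h3 : 2 * (n : ℝ) + 2 ≠ 0 := by positivity
    rw [cbin_succ]
    push_cast
    rw [show 2 * (n : ℝ) + 1 + (x + 2) = 2 * n + 3 + x by ring,
      show 2 * ((n : ℝ) + 1) + 1 + x = 2 * n + 3 + x by ring]
    field_simp
    ring

lemma wallis_zero : wallis 0 = Real.pi / 2 := by
  have h : ((wallis 0 : ℝ) : ℂ) = pochSum (1 / 2) 1 1 := by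
    rw [wallis, Complex.ofReal_tsum, pochSum]
    exact tsum_congr fun n => by rw [cbin_div_eq, Complex.ofReal_zero, add_zero]
  rw [pochSum_half_one_one] at h
  exact_mod_cast h

lemma wallis_one : wallis 1 = 1 := by
  have ht := hasSum_of_telescoping (T := cbin) (summable_cbin_div 1) (fun n => ?_) tendsto_cbin
  · rw [wallis, ht.tsum_eq, cbin_zero]
  · have h3 : 2 * (n : ℝ) + 2 ≠ 0 := by positivity
    rw [cbin_succ, show 2 * (n : ℝ) + 1 + 1 = 2 * n + 2 by ring]
    field_simp
    ring

/-- Logarithmic differentiation of the Wallis recurrence makes q(k) + q(k + 1) - 1/(k + 1)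
independent of k, where q = `wallisSq / wallis`. It tends to 0, so q(0) + q(1) = 1. -/
lemma wallisSq_zero : wallisSq 0 = Real.pi / 2 * (1 - wallisSq 1) := by
  let q : ℕ → ℝ := fun k => wallisSq k / wallis k
  have hq : ∀ k, q k ≤ 1 / ((k : ℝ) + 1) := fun k => by
    have hw := wallis_pos k.cast_nonneg
    rw [div_le_iff₀ hw, one_div_mul_eq_div]
    exact wallisSq_le k.cast_nonneg
  have hq0 : ∀ k, 0 ≤ q k := fun k =>
    div_nonneg (wallisSq_nonneg k.cast_nonneg) (wallis_pos k.cast_nonneg).le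
  have hstep : ∀ k : ℕ, 1 / ((k : ℝ) + 1) - q k = 1 / ((k : ℝ) + 2) - q (k + 2) := fun k => by
    have hk : (0 : ℝ) ≤ k := k.cast_nonneg
    have h1 := wallis_pos hk
    have h2 := wallis_pos (x := k + 2) (by linarith)
    have e1 := wallis_add_two hk
    have e2 := wallisSq_add_two hk
    have a1 : 1 / ((k : ℝ) + 1) - q k
        = (wallis k - (k + 1) * wallisSq k) / ((k + 1) * wallis k) := by
      simp only [q]
      field_simp
    have a2 : 1 / ((k : ℝ) + 2) - q (k + 2)
        = (wallis (k + 2) - (k + 2) * wallisSq (k + 2)) / ((k + 2) * wallis (k + 2)) := by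
      simp only [q]
      push_cast
      field_simp
    rw [a1, a2, e1, e2]
  have hconst : ∀ k, q k + q (k + 1) - 1 / ((k : ℝ) + 1) = q 0 + q 1 - 1 := fun k => by
    induction k with
    | zero => simp
    | succ k ih =>
      rw [← ih]
      have := hstep k
      push_cast
      rw [show (k : ℝ) + 1 + 1 = k + 2 by ring, show k + 1 + 1 = k + 2 by ring]
      linarith
  have hinv : Tendsto (fun k : ℕ => 1 / ((k : ℝ) + 1)) atTop (𝓝 0) :=
    tendsto_one_div_add_atTop_nhds_zero_nat
  have hql : Tendsto q atTop (𝓝 0) := squeeze_zero hq0 hq hinv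
  have hlim : Tendsto (fun k => q k + q (k + 1) - 1 / ((k : ℝ) + 1)) atTop (𝓝 0) := by
    simpa using (hql.add (hql.comp (tendsto_add_atTop_nat 1))).sub hinv
  rw [funext hconst] at hlim
  have h0 := tendsto_nhds_unique tendsto_const_nhds hlim
  simp only [q, Nat.cast_zero, Nat.cast_one, wallis_zero, wallis_one, div_one] at h0
  have hpi := Real.pi_pos
  field_simp at h0 ⊢
  linarith

lemma wallis_even (j : ℕ) : wallis (2 * j) = Real.pi / 2 * cbin j := by
  induction j with
  | zero => simp [wallis_zero, cbin_zero]
  | succ j ih =>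
    have h := wallis_add_two (x := 2 * j) (by positivity)
    rw [ih] at h
    push_cast
    rw [cbin_succ, show 2 * ((j : ℝ) + 1) = 2 * j + 2 by ring,
      ← mul_right_inj' (show 2 * (j : ℝ) + 2 ≠ 0 by positivity), ← h]
    field_simp

lemma wallis_odd (j : ℕ) : ((wallis (2 * j + 1) : ℝ) : ℂ) = poch 1 j / poch (3 / 2) j := by
  induction j with
  | zero => simp [wallis_one, poch_zero]
  | succ j ih =>
    have h := congrArg (Complex.ofReal) (wallis_add_two (x := 2 * j + 1) (by positivity))
    push_cast at h
    rw [ih] at h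
    have h1 := poch_ne_zero (a := 3 / 2) (by norm_num) j
    have h2 : (2 * (j : ℂ) + 3) ≠ 0 := two_mul_natCast_add_ne_zero (by norm_num) j
    push_cast
    rw [poch_succ, poch_succ, show 2 * ((j : ℝ) + 1) + 1 = 2 * j + 1 + 2 by ring,
      ← mul_right_inj' h2, show 3 / 2 + (j : ℂ) = (2 * j + 3) / 2 by ring]
    rw [show 2 * (j : ℂ) + 1 + 2 = 2 * j + 3 by ring] at h
    rw [← h]
    field_simp
    ring

/-! ### Catalan's constant as a hypergeometric series -/

/-- Iterating Y(s) = 1/s^2 - Y(s + 1) produces the alternating sum of 1/(s + k)^2, which at s = 1/2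
is four times Catalan's constant. -/
lemma pochSum_one_step {s : ℂ} (hs : 0 < s.re) :
    pochSum 1 (s + 1) (2 * s) / s = 1 / s ^ 2 - pochSum 1 (s + 1 + 1) (2 * (s + 1)) / (s + 1) := by
  have h1 : 0 < (1 : ℂ).re := by norm_num
  have hs1 : (1 : ℂ).re < (s + 1).re := by simpa using hs
  have hs2 : (1 : ℂ).re < (s + 1 + 1).re := by simp; linarith
  have hs0 : s ≠ 0 := by simpa using add_natCast_ne_zero hs 0
  have hs10 : s + 1 ≠ 0 := by simpa using add_natCast_ne_zero hs 1
  have hS := summable_pochSum h1 hs1 (2 * s)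
  have hS1 := (summable_nat_add_iff 1).mpr hS
  have hS2 := summable_pochSum h1 hs2 (2 * (s + 1))
  have htel := hasSum_of_telescoping
    (T := fun n : ℕ => 1 / (2 * s ^ 2) * (poch 1 n / poch (s + 1) n))
    ((hS1.div_const s).add (hS2.div_const (s + 1))) (fun n => ?_)
    (by
      have := (tendsto_poch_div_poch h1 hs1).const_mul (1 / (2 * s ^ 2))
      rwa [mul_zero] at this)
  · have e := htel.tsum_eq
    rw [(hS1.div_const s).tsum_add (hS2.div_const (s + 1)), tsum_div_const, tsum_div_const] at e
    have e0 := hS.tsum_eq_zero_add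
    rw [← pochSum] at e e0
    rw [e0]
    simp only [poch_zero, Nat.cast_zero, mul_zero, zero_add, one_mul, div_one, mul_one] at e ⊢
    have : 1 / (2 * s) / s = 1 / s ^ 2 - 1 / (2 * s ^ 2) := by
      field_simp
      norm_num
    linear_combination e + this
  · have hq := poch_ne_zero (a := s + 1) (h1.trans hs1) n
    have hn : s + 1 + n ≠ 0 := add_natCast_ne_zero (h1.trans hs1) n
    have e : poch (s + 1 + 1) n = poch (s + 1) n * (s + 1 + n) / (s + 1) := by
      rw [eq_div_iff hs10, ← poch_succ, poch_succ_left, mul_comm]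
    rw [e, poch_succ, poch_succ]
    push_cast
    rw [show 2 * ((n : ℂ) + 1) + 2 * s = 2 * (s + 1 + n) by ring,
      show 2 * (n : ℂ) + 2 * (s + 1) = 2 * (s + 1 + n) by ring]
    field_simp
    ring

lemma summable_catalan : Summable fun k : ℕ => (-1 : ℝ) ^ k / (2 * (k : ℝ) + 1) ^ 2 := by
  have h := (summable_nat_add_iff 1).mpr (Real.summable_nat_pow_inv.mpr one_lt_two)
  refine Summable.of_norm_bounded h fun k => ?_
  rw [norm_div, norm_pow, norm_neg, norm_one, one_pow, norm_pow, one_div]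
  have hk : (0 : ℝ) ≤ k := k.cast_nonneg
  rw [Real.norm_of_nonneg (by positivity)]
  push_cast
  gcongr
  linarith

lemma pochSum_one_eq_catalan : pochSum 1 (3 / 2) 1 = ((2 * catalanConst : ℝ) : ℂ) := by
  let Y : ℕ → ℂ := fun m => pochSum 1 (1 / 2 + m + 1) (2 * (1 / 2 + m)) / (1 / 2 + m)
  have hstep : ∀ m : ℕ, Y m = 1 / (1 / 2 + (m : ℂ)) ^ 2 - Y (m + 1) := fun m => by
    have := pochSum_one_step (s := 1 / 2 + m) (by norm_num; positivity)
    simp only [Y]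
    push_cast
    rw [this, add_assoc (1 / 2 : ℂ) m 1]
  have hsum : ∀ m : ℕ, ∑ k ∈ Finset.range m, (-1 : ℂ) ^ k / (1 / 2 + k) ^ 2
      = Y 0 - (-1) ^ m * Y m := fun m => by
    induction m with
    | zero => simp
    | succ m ih =>
      rw [Finset.sum_range_succ, ih, hstep m, pow_succ]
      ring
  set K : ℝ := ∑' n : ℕ, 2 * ((n : ℝ) + 1)⁻¹ ^ 2
  have hbound : ∀ m : ℕ, 1 ≤ m → ‖(-1) ^ m * Y m‖ ≤ K / m := fun m hm => by
    have hm' : (1 : ℝ) ≤ m := by exact_mod_cast hm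
    have hre : (1 / 2 + (m : ℂ)).re = 1 / 2 + m := by simp
    rw [norm_mul, norm_pow, norm_neg, norm_one, one_pow, one_mul, norm_div]
    have h1 : ‖pochSum 1 (1 / 2 + m + 1) (2 * (1 / 2 + m))‖ ≤ 1 * K := by
      refine norm_pochSum_le (by norm_num) (fun j => ?_) ?_ ?_
      · have : ‖(1 : ℂ) + j‖ = 1 + j := by
          rw [show (1 : ℂ) + j = ((1 + j : ℝ) : ℂ) by push_cast; ring, Complex.norm_real,
            Real.norm_of_nonneg (by positivity)]
        rw [this]
        refine mul_le_mul_of_nonneg_left (le_trans ?_ (Complex.re_le_norm _)) (by positivity)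
        rw [Complex.add_re, Complex.add_re, hre, Complex.natCast_re, Complex.one_re]
        linarith
      · rw [Complex.add_re, hre, Complex.one_re]
        linarith
      · rw [Complex.mul_re, hre]
        norm_num
        linarith
    rw [one_mul] at h1
    have h2 : (m : ℝ) ≤ ‖1 / 2 + (m : ℂ)‖ := by
      refine le_trans ?_ (Complex.re_le_norm _)
      rw [hre]
      linarith
    exact div_le_div₀ ((norm_nonneg _).trans h1) h1 (by linarith) h2
  have hzero : Tendsto (fun m : ℕ => (-1) ^ m * Y m) atTop (𝓝 0) := by
    refine squeeze_zero_norm' ?_ (tendsto_const_div_atTop_nhds_zero_nat K)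
    filter_upwards [eventually_ge_atTop 1] with m hm using hbound m hm
  have hlim : Tendsto (fun m : ℕ => ∑ k ∈ Finset.range m, (-1 : ℂ) ^ k / (1 / 2 + k) ^ 2)
      atTop (𝓝 (Y 0)) := by
    simp_rw [hsum]
    simpa using hzero.const_sub (Y 0)
  have hcat : HasSum (fun k : ℕ => (-1 : ℂ) ^ k / (1 / 2 + k) ^ 2) ((4 * catalanConst : ℝ) : ℂ) := by
    refine (hasSum_congr fun k => ?_).mpr
      (Complex.hasSum_ofReal.mpr (summable_catalan.hasSum.mul_left 4))
    have := two_mul_natCast_add_ne_zero (a := 1) (by norm_num) k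
    push_cast
    rw [show 1 / 2 + (k : ℂ) = (2 * k + 1) / 2 by ring]
    field_simp
    norm_num
  have h := tendsto_nhds_unique hlim hcat.tendsto_sum_nat
  simp only [Y, Nat.cast_zero, add_zero] at h
  norm_num at h
  push_cast
  linear_combination h / 2

/-! ### Harmonic numbers and the exchange of summation -/

lemma hasSum_wallis_odd :
    HasSum (fun j : ℕ => wallis (2 * j + 1) / (2 * j + 1)) (2 * catalanConst) := by
  refine Complex.hasSum_ofReal.mp ?_
  rw [← pochSum_one_eq_catalan]
  have h := (summable_pochSum (a := 1) (c := 3 / 2) (by norm_num) (by norm_num) 1).hasSum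
  refine (hasSum_congr fun j => ?_).mpr h
  rw [← div_div, ← wallis_odd]
  push_cast
  rfl

/-- By the even Wallis values each term is π/2 times c_j (2j + 1)/(2j + 2)^2. Splitting 2j + 1 = (2j
+ 2) - 1 gives π/2 (W(1) - `wallisSq 1`), which equals `wallisSq 0`. -/
lemma hasSum_wallis_even :
    HasSum (fun j : ℕ => wallis (2 * j + 2) / (2 * j + 2)) (wallisSq 0) := by
  have h := ((hasSum_wallis 1).sub (hasSum_wallisSq zero_le_one)).mul_left (Real.pi / 2)
  rw [wallis_one, ← wallisSq_zero] at h
  refine (hasSum_congr fun j => ?_).mpr h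
  have h1 : 2 * (j : ℝ) + 2 ≠ 0 := by positivity
  have := wallis_even (j + 1)
  push_cast at this
  rw [show 2 * (j : ℝ) + 2 = 2 * (j + 1) by ring, this, cbin_succ,
    show 2 * (j : ℝ) + 1 + 1 = 2 * j + 2 by ring, show 2 * ((j : ℝ) + 1) = 2 * j + 2 by ring]
  field_simp
  ring

lemma hasSum_wallis_div :
    HasSum (fun k : ℕ => wallis (k + 1) / (k + 1)) (2 * catalanConst + wallisSq 0) := by
  refine HasSum.even_add_odd ?_ ?_
  · simpa using hasSum_wallis_odd
  · refine (hasSum_congr fun j => ?_).mpr hasSum_wallis_even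
    push_cast
    rw [add_assoc, one_add_one_eq_two]

lemma hasSum_harmonic (N : ℕ) :
    HasSum (fun k : ℕ => 1 / ((k : ℝ) + 1) - 1 / (k + 1 + N)) (harmonic N : ℝ) := by
  have hdiff : ∀ N : ℕ, HasSum (fun k : ℕ => 1 / ((k : ℝ) + 1 + N) - 1 / (k + 2 + N))
      (1 / ((N : ℝ) + 1)) := fun N => by
    have hs : Summable fun k : ℕ => 1 / ((k : ℝ) + 1 + N) - 1 / (k + 2 + N) := by
      have h := (summable_nat_add_iff 1).mpr (Real.summable_nat_pow_inv.mpr one_lt_two)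
      refine Summable.of_nonneg_of_le (fun k => ?_) (fun k => ?_) h
      · rw [sub_nonneg]
        gcongr
        norm_num
      · have : 1 / ((k : ℝ) + 1 + N) - 1 / (k + 2 + N) = (((k : ℝ) + 1 + N) * (k + 2 + N))⁻¹ := by
          field_simp
          ring
        rw [this, sq]
        push_cast
        have hN : (0 : ℝ) ≤ N := N.cast_nonneg
        have hk : (0 : ℝ) ≤ k := k.cast_nonneg
        exact inv_anti₀ (by positivity)
          (mul_le_mul (by linarith) (by linarith) (by positivity) (by positivity))
    have hT : Tendsto (fun k : ℕ => 1 / ((k : ℝ) + 1 + N)) atTop (𝓝 0) := by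
      refine squeeze_zero (fun k => by positivity) (fun k => ?_)
        tendsto_one_div_add_atTop_nhds_zero_nat
      have hN : (0 : ℝ) ≤ N := N.cast_nonneg
      exact one_div_le_one_div_of_le (by positivity) (by linarith)
    have := hasSum_of_telescoping hs (fun k => ?_) hT
    · simpa [add_comm] using this
    · push_cast
      ring
  induction N with
  | zero => simp
  | succ N ih =>
    rw [harmonic_succ]
    push_cast
    rw [← one_div]
    refine (hasSum_congr fun k => ?_).mpr (ih.add (hdiff N))
    ring

lemma hasSum_cbin_mul_harmonic_succ :
    HasSum (fun n : ℕ => cbin n / (2 * n + 1) * (harmonic (2 * n + 1) : ℝ))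
      (2 * catalanConst + wallisSq 0) := by
  let f : ℕ × ℕ → ℝ := fun p => cbin p.2 / (2 * p.2 + 1 + (p.1 + 1)) / (p.1 + 1)
  have hinner : ∀ k : ℕ, HasSum (fun n => f (k, n)) (wallis (k + 1) / (k + 1)) := fun k =>
    (hasSum_wallis (k + 1)).div_const _
  have hf : Summable f := by
    refine (summable_prod_of_nonneg fun p => ?_).mpr ⟨fun k => (hinner k).summable, ?_⟩
    · have := cbin_pos p.2
      simp only [f, Pi.zero_apply]
      positivity
    · simp_rw [fun k => (hinner k).tsum_eq]
      exact hasSum_wallis_div.summable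
  have htot : HasSum f (2 * catalanConst + wallisSq 0) := by
    rw [← (hf.hasSum.prod_fiberwise hinner).unique hasSum_wallis_div]
    exact hf.hasSum
  have hswap : HasSum (fun p : ℕ × ℕ => f p.swap) (2 * catalanConst + wallisSq 0) :=
    (Equiv.prodComm ℕ ℕ).hasSum_iff.mpr htot
  refine hswap.prod_fiberwise fun n => ?_
  -- Partial fractions: 1/((k + 1)(k + 2n + 2)) is the difference of reciprocals divided by 2n + 1.
  refine (hasSum_congr fun k => ?_).mpr ((hasSum_harmonic (2 * n + 1)).mul_left _)
  have h1 : 2 * (n : ℝ) + 1 ≠ 0 := by positivity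
  have h2 : (k : ℝ) + 1 ≠ 0 := by positivity
  have h3 : (k : ℝ) + 2 * n + 2 ≠ 0 := by positivity
  simp only [f, Prod.fst_swap, Prod.snd_swap]
  push_cast
  rw [show 2 * (n : ℝ) + 1 + (k + 1) = k + 2 * n + 2 by ring,
    show (k : ℝ) + 1 + (2 * n + 1) = k + 2 * n + 2 by ring]
  field_simp
  ring

theorem hasSum_catalanConst :
    HasSum (fun n : ℕ => (1 / 2 : ℝ) ^ (2 * (n + 1) + 1) / (2 * ((n : ℝ) + 1) + 1)
      * ((2 * (n + 1)).choose (n + 1) : ℝ) * (harmonic (2 * (n + 1)) : ℝ)) catalanConst := by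
  have h1 : HasSum (fun n : ℕ => cbin n / (2 * n + 1) * (harmonic (2 * n) : ℝ))
      (2 * catalanConst) := by
    -- Replacing H_{2n+1} by H_{2n} subtracts c_n/(2n + 1)^2, whose sum `wallisSq 0` cancels the
    -- even part.
    have h := hasSum_cbin_mul_harmonic_succ.sub (hasSum_wallisSq le_rfl)
    rw [add_sub_cancel_right] at h
    refine (hasSum_congr fun n => ?_).mpr h
    have : 2 * (n : ℝ) + 1 ≠ 0 := by positivity
    rw [harmonic_succ]
    push_cast
    rw [add_zero]
    field_simp
    ring
  -- The sum may start at n = 1 because H_0 = 0.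
  have h2 := ((hasSum_nat_add_iff' 1).mpr h1).div_const 2
  simp only [Finset.range_one, Finset.sum_singleton, mul_zero, harmonic_zero, Rat.cast_zero,
    sub_zero] at h2
  rw [mul_div_cancel_left₀ _ two_ne_zero] at h2
  refine (hasSum_congr fun n => ?_).mpr h2
  rw [cbin, Nat.centralBinom_eq_two_mul_choose, pow_succ, pow_mul]
  push_cast
  rw [div_pow, one_pow, show ((2 : ℝ) ^ 2) = 4 by norm_num, div_pow, one_pow]
  field_simp

/-! ### The Gauss series at 1 -/

theorem ordinaryHypergeometric_half :
    ordinaryHypergeometric (1 / 2 : ℝ) (1 / 2) (3 / 2) (1 : ℝ) = Real.pi / 2 := by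
  rw [ordinaryHypergeometric_eq_tsum, ← wallis_zero, wallis]
  refine tsum_congr fun n => ?_
  have key : ∀ x : ℝ, (((ascPochhammer ℝ n).eval x : ℝ) : ℂ) = poch x n := fun x => by
    rw [poch, ← ascPochhammer_map (algebraMap ℝ ℂ), Polynomial.eval_map_algebraMap,
      ← Complex.coe_algebraMap, Polynomial.aeval_algebraMap_apply]
    simp
  refine Complex.ofReal_injective ?_
  rw [cbin_div_eq]
  simp only [one_pow, smul_eq_mul, mul_one]
  push_cast
  rw [key, key]
  push_cast
  have hn : (1 / 2 : ℂ) + n ≠ 0 := add_natCast_ne_zero (by norm_num) n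
  have hp := poch_ne_zero (a := 3 / 2) (by norm_num) n
  have hf := poch_ne_zero (a := 1) (by norm_num) n
  have h : poch (1 / 2) n * (1 / 2 + n) = 1 / 2 * poch (3 / 2) n := by
    rw [← poch_succ, poch_succ_left]
    norm_num
  have h2 : poch (3 / 2) n = poch (1 / 2) n * (2 * n + 1) := by linear_combination -2 * h
  have hh := poch_ne_zero (a := 1 / 2) (by norm_num) n
  have h3 : 2 * (n : ℂ) + 1 ≠ 0 := two_mul_natCast_add_ne_zero (by norm_num) n
  rw [← poch_one, h2, add_zero]
  field_simp

end Ladder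

end

theorem mainTheorem8 :
    -- the generators `F(t)`, `G(t)` of the ladders, near `t = 0`
    (∀ t : ℂ, ‖t‖ < 1 / 2 →
      HasSum (fun n : ℕ => 2 * ((Ladder.B (n + 1) : ℂ) + Complex.I * (Ladder.F (n + 1) : ℂ))
        * t ^ (n + 1)) (Ladder.genF t)) ∧
    (∀ t : ℂ, ‖t‖ < 1 →
      HasSum (fun n : ℕ => 2 * ((Ladder.D (n + 1) : ℂ) + Complex.I * (Ladder.G (n + 1) : ℂ))
        * t ^ (n + 1)) (Ladder.genG t)) ∧
    -- the shift recurrences, at every `t` where all terms are defined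
    (∀ t : ℂ, (∀ k : ℕ, 2 * t ≠ k) →
      2 * Ladder.genF t / t - (Complex.I * Ladder.genF (t - 1) - Complex.I) / (t - 1)
        = (2 + 2 * Complex.I) / (1 - 2 * t)) ∧
    (∀ t : ℂ, (∀ k : ℕ, t ≠ k ∧ 2 * t ≠ 3 * k) →
      2 ^ 3 * Ladder.genG t / t - (Complex.I * Ladder.genG (t - 3) - Complex.I) / (t - 3)
        = (12 + 12 * Complex.I) / (3 - 2 * t) + 8 * Complex.I / (1 - t) + 4 / (2 - t)) ∧
    -- the hypergeometric form of `Im F(t)`, on the half-plane of convergence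
    (∀ t : ℂ, t.re < 1 / 2 →
      Summable (Ladder.hyp3F2Term (1 / 2 - t / 2) (1 / 2) 1 (3 / 2 - t / 2) (1 - t) 1) ∧
      Ladder.imGen Ladder.genF t
        = t * (1 - t)⁻¹ * Ladder.hyp3F2 (1 / 2 - t / 2) (1 / 2) 1 (3 / 2 - t / 2) (1 - t) 1) ∧
    -- the same as a power series in `t`
    (∀ t : ℂ, ‖t‖ < 1 / 2 →
      HasSum (fun n : ℕ => 2 * (Ladder.F (n + 1) : ℂ) * t ^ (n + 1))
        (t * (1 - t)⁻¹ * Ladder.hyp3F2 (1 / 2 - t / 2) (1 / 2) 1 (3 / 2 - t / 2) (1 - t) 1)) ∧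
    -- the hypergeometric form of `Im G(t)`, on the half-plane of convergence
    (∀ t : ℂ, t.re < 3 / 2 → t ≠ 1 →
      Summable (Ladder.hyp3F2Term
        (1 / 2 - t / 2) (1 / 2 - t / 3) 1 (3 / 2 - t / 2) (1 - 2 * t / 3) 1) ∧
      Ladder.imGen Ladder.genG t
        = t * (1 - t)⁻¹ * Ladder.hyp3F2
            (1 / 2 - t / 2) (1 / 2 - t / 3) 1 (3 / 2 - t / 2) (1 - 2 * t / 3) 1) ∧
    -- the same as a power series in `t`
    (∀ t : ℂ, ‖t‖ < 1 →
      HasSum (fun n : ℕ => 2 * (Ladder.G (n + 1) : ℂ) * t ^ (n + 1))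
        (t * (1 - t)⁻¹ * Ladder.hyp3F2
          (1 / 2 - t / 2) (1 / 2 - t / 3) 1 (3 / 2 - t / 2) (1 - 2 * t / 3) 1)) ∧
    -- the terms of order `t`
    (2 * Ladder.F 1 = ordinaryHypergeometric (1 / 2 : ℝ) (1 / 2) (3 / 2) (1 : ℝ) ∧
      2 * Ladder.G 1 = ordinaryHypergeometric (1 / 2 : ℝ) (1 / 2) (3 / 2) (1 : ℝ) ∧
      ordinaryHypergeometric (1 / 2 : ℝ) (1 / 2) (3 / 2) (1 : ℝ) = Real.pi / 2) ∧
    -- the series for Catalan's constant, summed over `n + 1 = 1, 2, …`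
    HasSum (fun n : ℕ => (1 / 2 : ℝ) ^ (2 * (n + 1) + 1) / (2 * ((n : ℝ) + 1) + 1)
      * ((2 * (n + 1)).choose (n + 1) : ℝ) * (harmonic (2 * (n + 1)) : ℝ))
      Ladder.catalanConst := by
  open Ladder in
  refine ⟨fun t ht => hasSum_genF ht, fun t ht => hasSum_genG ht, genF_shift, genG_shift,
    fun t ht => imGen_genF_eq ht, fun t ht => ?_, fun t ht ht1 => imGen_genG_eq ht ht1,
    fun t ht => ?_, ⟨?_, ?_, ordinaryHypergeometric_half⟩, hasSum_catalanConst⟩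
  · have hre : t.re < 1 / 2 := (Complex.re_le_norm t).trans_lt ht
    rw [← (imGen_genF_eq hre).2]
    exact hasSum_F ht
  · have hre : t.re < 3 / 2 := ((Complex.re_le_norm t).trans_lt ht).trans (by norm_num)
    have ht1 : t ≠ 1 := by
      rintro rfl
      simp at ht
    rw [← (imGen_genG_eq hre ht1).2]
    exact hasSum_G ht
  · rw [ordinaryHypergeometric_half, F_one]
    ring
  · rw [ordinaryHypergeometric_half, two_mul_G_one]
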